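/- Let $\mathbb{K}$ be a field, $\mathbb{K}^*=\mathbb{K}\setminus\{0\}$, and let $q\in\mathbb{K}^*$ be an element which is not a root of unity. Let $A$ be the quantum spatial ageing algebra, i.e. the associative unital $\mathbb{K}$-algebra generated by $E, K, K^{-1}, X, Y$ subject to the defining relations $KK^{-1}=K^{-1}K=1$ and $$EK=q^{-2}KE,\quad XK=q^{-1}KX,\quad YK=qKY,\quad EX=qXE,\quad EY=X+q^{-1}YE,\quad qYX=XY,$$ and let $\varphi=EY-qYE\in A$. For all $\lambda,\mu,\gamma\in\mathbb{K}^*$ and $i\in\mathbb{Z}$ there is a $\mathbb{K}$-algebra automorphism $\sigma_{\lambda,\mu,\gamma,i}$ of $A$ with $$X\mapsto\lambda K^iX,\quad Y\mapsto\mu K^{-i}Y,\quad K\mapsto\gamma K,\quad E\mapsto\lambda\mu^{-1}q^{-2i}K^{2i}E,$$ and it satisfies $\sigma_{\lambda,\mu,\gamma,i}(\varphi)=\lambda K^i\varphi$. The group of $\mathbb{K}$-algebra automorphisms of $A$ is $$\mathrm{Aut}_{\mathbb{K}}(A)=\{\sigma_{\lambda,\mu,\gamma,i}\mid\lambda,\mu,\gamma\in\mathbb{K}^*,\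 i\in\mathbb{Z}\}.$$ Furthermore, $$\sigma_{\lambda,\mu,\gamma,i}\,\sigma_{\lambda',\mu',\gamma',j}=\sigma_{\lambda\lambda'\gamma^j,\ \mu\mu'\gamma^{-j},\ \gamma\gamma',\ i+j},\qquad \sigma_{\lambda,\mu,\gamma,i}^{-1}=\sigma_{\lambda^{-1}\gamma^i,\ \mu^{-1}\gamma^{-i},\ \gamma^{-1},\ -i},$$ where the product of automorphisms is composition, $(\sigma\tau)(a)=\sigma(\tau(a))$. Finally, $\mathrm{Aut}_{\mathbb{K}}(A)\simeq(\mathbb{K}^*)^3\rtimes\mathbb{Z}$, where $i\in\mathbb{Z}$ acts on $(\mathbb{K}^*)^3$ by $(\lambda,\mu,\gamma)\mapsto(\lambda\gamma^{-i},\mu\gamma^{i},\gamma)$; more precisely, there is a group isomorphism $(\mathbb{K}^*)^3\rtimes\mathbb{Z}\to\mathrm{Aut}_{\mathbb{K}}(A)$ that sends $(\lambda,\mu,\gamma)\in(\mathbb{K}^*)^3$ to $\sigma_{\lambda,\mu,\gamma,0}$ and $i\in\mathbb{Z}$ to $\sigma_{1,1,1,i}$. -/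

import Mathlib

/-- The symbols for the generators `E, K, K⁻¹, X, Y`. -/
inductive AgeingGen : Type
  | E | K | Kinv | X | Y

namespace AgeingGen

/-- The symbols as elements of the free associative algebra. -/
abbrev free (𝕜 : Type*) [Field 𝕜] (g : AgeingGen) : FreeAlgebra 𝕜 AgeingGen :=
  FreeAlgebra.ι 𝕜 g

end AgeingGen

open AgeingGen in
/-- The defining relations of the quantum spatial ageing algebra; the first two say that the
generators `K` and `K⁻¹` are inverse to each other. -/
inductive AgeingRel {𝕜 : Type*} [Field 𝕜] (q : 𝕜) :
    FreeAlgebra 𝕜 AgeingGen → FreeAlgebra 𝕜 AgeingGen → Prop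
  | K_mul_Kinv : AgeingRel q (free 𝕜 K * free 𝕜 Kinv) 1
  | Kinv_mul_K : AgeingRel q (free 𝕜 Kinv * free 𝕜 K) 1
  | E_mul_K : AgeingRel q (free 𝕜 E * free 𝕜 K) ((q ^ 2)⁻¹ • (free 𝕜 K * free 𝕜 E))
  | X_mul_K : AgeingRel q (free 𝕜 X * free 𝕜 K) (q⁻¹ • (free 𝕜 K * free 𝕜 X))
  | Y_mul_K : AgeingRel q (free 𝕜 Y * free 𝕜 K) (q • (free 𝕜 K * free 𝕜 Y))
  | E_mul_X : AgeingRel q (free 𝕜 E * free 𝕜 X) (q • (free 𝕜 X * free 𝕜 E))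
  | E_mul_Y : AgeingRel q (free 𝕜 E * free 𝕜 Y)
      (free 𝕜 X + q⁻¹ • (free 𝕜 Y * free 𝕜 E))
  | Y_mul_X : AgeingRel q (q • (free 𝕜 Y * free 𝕜 X)) (free 𝕜 X * free 𝕜 Y)

/-- The quantum spatial ageing algebra over `𝕜` with parameter `q`: the associative unital
`𝕜`-algebra given by the generators and relations above. -/
abbrev AgeingAlgebra (𝕜 : Type*) [Field 𝕜] (q : 𝕜) : Type _ := RingQuot (AgeingRel q)

namespace AgeingAlgebra

noncomputable section

variable {𝕜 : Type*} [Field 𝕜] (q : 𝕜)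

/-- The image of a generator in the algebra. -/
def gen (g : AgeingGen) : AgeingAlgebra 𝕜 q :=
  RingQuot.mkAlgHom 𝕜 (AgeingRel q) (FreeAlgebra.ι 𝕜 g)

/-- The generator `E`. -/
def E : AgeingAlgebra 𝕜 q := gen q AgeingGen.E

/-- The generator `X`. -/
def X : AgeingAlgebra 𝕜 q := gen q AgeingGen.X

/-- The generator `Y`. -/
def Y : AgeingAlgebra 𝕜 q := gen q AgeingGen.Y

/-- The generator `K` as a unit of the algebra, with inverse the generator `K⁻¹`. -/
def Ku : (AgeingAlgebra 𝕜 q)ˣ where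
  val := gen q AgeingGen.K
  inv := gen q AgeingGen.Kinv
  val_inv := by
    simpa [gen] using RingQuot.mkAlgHom_rel 𝕜 (AgeingRel.K_mul_Kinv (q := q))
  inv_val := by
    simpa [gen] using RingQuot.mkAlgHom_rel 𝕜 (AgeingRel.Kinv_mul_K (q := q))

/-- The integer power `K ^ i` in the algebra. -/
def Kpow (i : ℤ) : AgeingAlgebra 𝕜 q := ((Ku q ^ i : (AgeingAlgebra 𝕜 q)ˣ) : AgeingAlgebra 𝕜 q)

/-- The element `φ = E Y - q Y E`. -/
def phi : AgeingAlgebra 𝕜 q := E q * Y q - q • (Y q * E q)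

end

/-- The action of `ℤ` (written multiplicatively) on `(𝕜ˣ)³` by group automorphisms, in which `i`
sends `(l, m, g)` to `(l g⁻ⁱ, m gⁱ, g)`. -/
def torusAction (𝕜 : Type*) [Field 𝕜] : Multiplicative ℤ →* MulAut (𝕜ˣ × 𝕜ˣ × 𝕜ˣ) where
  toFun i :=
    { toFun := fun t =>
        (t.1 * t.2.2 ^ (-i.toAdd), t.2.1 * t.2.2 ^ i.toAdd, t.2.2)
      invFun := fun t =>
        (t.1 * t.2.2 ^ i.toAdd, t.2.1 * t.2.2 ^ (-i.toAdd), t.2.2)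
      left_inv := fun t => by simp
      right_inv := fun t => by simp
      map_mul' := fun s t => by
        simp only [Prod.fst_mul, Prod.snd_mul, mul_zpow, Prod.mk_mul_mk, Prod.mk.injEq, and_true]
        exact ⟨mul_mul_mul_comm _ _ _ _, mul_mul_mul_comm _ _ _ _⟩ }
  map_one' := by ext t <;> simp
  map_mul' i j := by
    refine MulEquiv.ext fun t => ?_
    simp only [toAdd_mul, neg_add, zpow_add, MulAut.mul_apply, MulEquiv.coe_mk, Equiv.coe_fn_mk,
      Prod.mk.injEq, and_true]
    exact ⟨by rw [mul_assoc, mul_comm (t.2.2 ^ (-i.toAdd))],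
      by rw [mul_assoc, mul_comm (t.2.2 ^ i.toAdd)]⟩

end AgeingAlgebra

/-! Since `φ = X + (q⁻¹ - q) Y E`, inverting `Y` turns `E` into `(q⁻¹ - q)⁻¹ Y⁻¹ (φ - X)`, and `A`
embeds in the quantum torus on `Y, K, X, φ`, a twisted group algebra of ℤ⁴. Injectivity
(`toTorus_injective`) holds because the monomials `K^k X^i Y^b E^c` span `A` and their images are
triangular. As ℤ⁴ can be totally ordered, leading-term arguments apply in the torus.

Two kinds of elements are preserved by every automorphism τ. Units of the torus are monomials, and
those lying in `A` together with their inverses are the `c K^n` (`toTorus_unit`). Elements `x ≠ 0`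
with `x A ⊆ A x` are the `c K^k X^i φ^j` (`IsNormalizing.toTorus_eq`), and `X` and `φ` are among
them. Comparing commutation with `K` gives `τK = gK` and shows that `τX`, `τφ` are each a multiple
of `K^p X` or `K^p φ`.

The product `τY τE` is a combination of `τφ` and `τX`; comparing leading `Y`-degrees and `K`-weights
leaves only terms `K^k Y` in `τY`. Since `YX = q⁻¹XY` but `Yφ = qφY`, the automorphism cannot
exchange `X` and `φ`, and `k = -p`. Finally, the only combinations of `X` and `φ` in the right ideal
`YA` are multiples of `φ - X` (`eq_of_Y_mul_eq`), so `τX` and `τφ` carry the same scalar; `τE` is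
then recovered by cancelling `τY`. The group structure follows from the composition formula
`sigma_mul`. -/

/-! ### Twisted group algebras -/

/-- The twisted group algebra of `G` over `𝕜`, in which `single u 1 * single v 1` is
`q ^ B u v • single (u + v) 1`. -/
def TwistedAlgebra {𝕜 G : Type*} [Field 𝕜] [AddCommGroup G] (_q : 𝕜ˣ) (_B : G →+ G →+ ℤ) : Type _ :=
  G →₀ 𝕜

namespace TwistedAlgebra

noncomputable section

variable {𝕜 G : Type*} [Field 𝕜] [AddCommGroup G] (q : 𝕜ˣ) (B : G →+ G →+ ℤ)

instance : AddCommGroup (TwistedAlgebra q B) := inferInstanceAs (AddCommGroup (G →₀ 𝕜))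

instance : Module 𝕜 (TwistedAlgebra q B) := inferInstanceAs (Module 𝕜 (G →₀ 𝕜))

/-- The multiplication as a bilinear map. -/
def mulₗ : (G →₀ 𝕜) →ₗ[𝕜] (G →₀ 𝕜) →ₗ[𝕜] (G →₀ 𝕜) :=
  Finsupp.lsum 𝕜 fun u => LinearMap.toSpanSingleton 𝕜 ((G →₀ 𝕜) →ₗ[𝕜] (G →₀ 𝕜))
    (Finsupp.lsum 𝕜 fun v => ((q ^ B u v : 𝕜ˣ) : 𝕜) • Finsupp.lsingle (u + v))

theorem mulₗ_single_single (u v : G) (a b : 𝕜) :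
    mulₗ q B (Finsupp.single u a) (Finsupp.single v b) =
      Finsupp.single (u + v) (((q ^ B u v : 𝕜ˣ) : 𝕜) * (a * b)) := by
  simp only [mulₗ, Finsupp.lsum_single, LinearMap.toSpanSingleton_apply, LinearMap.smul_apply,
    Finsupp.lsingle_apply, Finsupp.smul_single, smul_eq_mul]
  congr 1
  ring

/-- A bilinear form is a 2-cocycle: both bracketings give the exponent `B u v + B u w + B v w`. -/
theorem mulₗ_assoc (f g h : G →₀ 𝕜) :
    mulₗ q B (mulₗ q B f g) h = mulₗ q B f (mulₗ q B g h) := by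
  induction f using Finsupp.induction_linear with
  | zero => simp
  | add f f' hf hf' => simp only [map_add, LinearMap.add_apply, hf, hf']
  | single u a =>
    induction g using Finsupp.induction_linear with
    | zero => simp
    | add f f' hf hf' => simp only [map_add, LinearMap.add_apply, hf, hf']
    | single v b =>
      induction h using Finsupp.induction_linear with
      | zero => simp
      | add f f' hf hf' => simp only [map_add, hf, hf']
      | single w c =>
        simp only [mulₗ_single_single, map_add, AddMonoidHom.add_apply, zpow_add, Units.val_mul,
          add_assoc]
        congr 1
        ring

/-- The element `a • M_u`. -/
def single (u : G) (a : 𝕜) : TwistedAlgebra q B := Finsupp.single u a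

/-- The coefficient at `u`, as a linear map. -/
def coeff (u : G) : TwistedAlgebra q B →ₗ[𝕜] 𝕜 := Finsupp.lapply u

instance : Mul (TwistedAlgebra q B) := ⟨fun f g => mulₗ q B f g⟩

instance : One (TwistedAlgebra q B) := ⟨single q B 0 1⟩

theorem mul_def (f g : TwistedAlgebra q B) : f * g = mulₗ q B f g := rfl

theorem one_def : (1 : TwistedAlgebra q B) = single q B 0 1 := rfl

theorem single_mul_single (u v : G) (a b : 𝕜) :
    single q B u a * single q B v b =
      single q B (u + v) (((q ^ B u v : 𝕜ˣ) : 𝕜) * (a * b)) :=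
  mulₗ_single_single q B u v a b

@[elab_as_elim]
theorem induction_single {p : TwistedAlgebra q B → Prop} (f : TwistedAlgebra q B) (zero : p 0)
    (add : ∀ f g, p f → p g → p (f + g)) (single : ∀ u a, p (single q B u a)) : p f :=
  Finsupp.induction_linear (motive := p) f zero add single

instance : Ring (TwistedAlgebra q B) where
  __ := (inferInstance : AddCommGroup (TwistedAlgebra q B))
  left_distrib f g h := map_add (mulₗ q B f) g h
  right_distrib f g h := by simp only [mul_def]; exact LinearMap.map_add₂ (mulₗ q B) f g h
  zero_mul f := by simp only [mul_def]; exact LinearMap.map_zero₂ (mulₗ q B) f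
  mul_zero f := map_zero (mulₗ q B f)
  mul_assoc f g h := mulₗ_assoc q B f g h
  one_mul f := by
    induction f using induction_single with
    | zero => exact map_zero _
    | add f g hf hg => exact (map_add (mulₗ q B _) f g).trans (congrArg₂ _ hf hg)
    | single u a => simp [one_def, single_mul_single]
  mul_one f := by
    induction f using induction_single with
    | zero => exact LinearMap.map_zero₂ (mulₗ q B) _
    | add f g hf hg => exact (LinearMap.map_add₂ (mulₗ q B) f g _).trans (congrArg₂ _ hf hg)
    | single u a => simp [one_def, single_mul_single]

instance : Algebra 𝕜 (TwistedAlgebra q B) :=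
  Algebra.ofModule (fun r f g => LinearMap.map_smul₂ (mulₗ q B) r f g)
    (fun r f g => map_smul (mulₗ q B f) r g)

variable {q B}

theorem ext_coeff {f g : TwistedAlgebra q B} (h : ∀ u, coeff q B u f = coeff q B u g) : f = g :=
  Finsupp.ext h

theorem coeff_single [DecidableEq G] (u v : G) (a : 𝕜) :
    coeff q B v (single q B u a) = if u = v then a else 0 :=
  Finsupp.single_apply

theorem coeff_single_same (u : G) (a : 𝕜) : coeff q B u (single q B u a) = a :=
  Finsupp.single_eq_same

theorem smul_single (r : 𝕜) (u : G) (a : 𝕜) : r • single q B u a = single q B u (r * a) :=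
  Finsupp.smul_single r u a

theorem single_ne_zero {u : G} {a : 𝕜} (ha : a ≠ 0) : single q B u a ≠ 0 :=
  Finsupp.single_ne_zero.2 ha

theorem exists_coeff_ne_zero {f : TwistedAlgebra q B} (hf : f ≠ 0) : ∃ u, coeff q B u f ≠ 0 := by
  by_contra! h
  exact hf (ext_coeff fun u => by rw [h u, map_zero])

theorem coeff_single_mul (u v : G) (a : 𝕜) (f : TwistedAlgebra q B) :
    coeff q B (u + v) (single q B u a * f) = ((q ^ B u v : 𝕜ˣ) : 𝕜) * (a * coeff q B v f) := by
  classical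
  induction f using induction_single with
  | zero => simp
  | add f g hf hg => simp only [mul_add, map_add, hf, hg]
  | single w b =>
    simp only [single_mul_single, coeff_single, add_right_inj]
    split_ifs with h
    · rw [h]
    · simp

theorem coeff_mul_single (u v : G) (a : 𝕜) (f : TwistedAlgebra q B) :
    coeff q B (v + u) (f * single q B u a) = ((q ^ B v u : 𝕜ˣ) : 𝕜) * (coeff q B v f * a) := by
  classical
  induction f using induction_single with
  | zero => simp
  | add f g hf hg => simp only [add_mul, map_add, hf, hg, mul_add]
  | single w b =>
    simp only [single_mul_single, coeff_single, add_left_inj]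
    split_ifs with h
    · rw [h]
    · simp

theorem mul_eq_sum (f g : TwistedAlgebra q B) :
    f * g = ∑ u ∈ Finsupp.support f, ∑ v ∈ Finsupp.support g,
      single q B (u + v) (((q ^ B u v : 𝕜ˣ) : 𝕜) * (coeff q B u f * coeff q B v g)) := by
  have hf : f = ∑ u ∈ Finsupp.support f, single q B u (coeff q B u f) := (Finsupp.sum_single f).symm
  have hg : g = ∑ v ∈ Finsupp.support g, single q B v (coeff q B v g) := (Finsupp.sum_single g).symm
  conv_lhs => rw [hf, hg]
  simp only [Finset.sum_mul, Finset.mul_sum, single_mul_single]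
  exact Finset.sum_comm

theorem mem_support {f : TwistedAlgebra q B} {u : G} :
    u ∈ Finsupp.support f ↔ coeff q B u f ≠ 0 := Finsupp.mem_support_iff

/-- The support of a product lies in the sum of the supports. -/
theorem exists_of_coeff_mul_ne_zero {f g : TwistedAlgebra q B} {w : G}
    (h : coeff q B w (f * g) ≠ 0) :
    ∃ u v, coeff q B u f ≠ 0 ∧ coeff q B v g ≠ 0 ∧ w = u + v := by
  classical
  rw [mul_eq_sum, map_sum] at h
  obtain ⟨u, hu, h⟩ := Finset.exists_ne_zero_of_sum_ne_zero h
  rw [map_sum] at h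
  obtain ⟨v, hv, h⟩ := Finset.exists_ne_zero_of_sum_ne_zero h
  rw [coeff_single] at h
  exact ⟨u, v, mem_support.1 hu, mem_support.1 hv, by by_contra h'; exact h (if_neg (Ne.symm h'))⟩

theorem exists_top {Γ : Type*} [AddCommGroup Γ] [LinearOrder Γ] {f : TwistedAlgebra q B}
    (h : G →+ Γ) (hf : f ≠ 0) :
    ∃ u, coeff q B u f ≠ 0 ∧ ∀ u', coeff q B u' f ≠ 0 → h u' ≤ h u := by
  obtain ⟨u₀, hu₀⟩ := exists_coeff_ne_zero hf
  obtain ⟨u, hu, hmax⟩ := Finset.exists_max_image (Finsupp.support f) h ⟨u₀, mem_support.2 hu₀⟩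
  exact ⟨u, mem_support.1 hu, fun u' hu' => hmax u' (mem_support.2 hu')⟩

/-! ### Leading terms, normalizing elements and units when the exponent group is ordered -/

section Order

variable {Γ : Type*} [AddCommGroup Γ] [LinearOrder Γ] [IsOrderedAddMonoid Γ]

/-- No cancellation occurs at the sum of the two largest exponents, because no other pair of
exponents has this sum. -/
theorem coeff_top_mul {f g : TwistedAlgebra q B} {h : G →+ Γ} (hh : Function.Injective h) {u v : G}
    (hu : ∀ u', coeff q B u' f ≠ 0 → h u' ≤ h u) (hv : ∀ v', coeff q B v' g ≠ 0 → h v' ≤ h v) :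
    coeff q B (u + v) (f * g) = ((q ^ B u v : 𝕜ˣ) : 𝕜) * (coeff q B u f * coeff q B v g) := by
  classical
  have key : ∀ u' v', coeff q B u' f ≠ 0 → coeff q B v' g ≠ 0 → u' + v' = u + v →
      u' = u ∧ v' = v := fun u' v' hu' hv' e => by
    have e' : h u' + h v' = h u + h v := by rw [← map_add, ← map_add, e]
    have := (add_eq_add_iff_eq_and_eq (hu u' hu') (hv v' hv')).1 e'
    exact ⟨hh this.1, hh this.2⟩
  rw [mul_eq_sum, map_sum, Finset.sum_eq_single u, map_sum, Finset.sum_eq_single v,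
    coeff_single_same]
  · intro v' hv' hne
    rw [coeff_single, if_neg fun e => hne (add_left_cancel e)]
  · intro h0
    rw [mem_support, not_not] at h0
    simp [h0, coeff_single]
  · intro u' hu' hne
    rw [map_sum]
    refine Finset.sum_eq_zero fun v' hv' => ?_
    rw [coeff_single, if_neg fun e => hne (key u' v' (mem_support.1 hu') (mem_support.1 hv') e).1]
  · intro h0
    rw [mem_support, not_not] at h0
    simp [h0, coeff_single]

theorem exists_top_mul {f g : TwistedAlgebra q B} {h : G →+ Γ} (hh : Function.Injective h)
    (hf : f ≠ 0) (hg : g ≠ 0) :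
    ∃ u v, coeff q B u f ≠ 0 ∧ coeff q B v g ≠ 0 ∧ (∀ u', coeff q B u' f ≠ 0 → h u' ≤ h u) ∧
      (∀ v', coeff q B v' g ≠ 0 → h v' ≤ h v) ∧ coeff q B (u + v) (f * g) ≠ 0 := by
  obtain ⟨u, hu, hu'⟩ := exists_top h hf
  obtain ⟨v, hv, hv'⟩ := exists_top h hg
  refine ⟨u, v, hu, hv, hu', hv', ?_⟩
  rw [coeff_top_mul hh hu' hv']
  exact mul_ne_zero (Units.ne_zero _) (mul_ne_zero hu hv)

theorem mul_ne_zero_of_injective {f g : TwistedAlgebra q B} {h : G →+ Γ}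
    (hh : Function.Injective h) (hf : f ≠ 0) (hg : g ≠ 0) : f * g ≠ 0 := by
  obtain ⟨u, v, -, -, -, -, hne⟩ := exists_top_mul hh hf hg
  intro h0
  rw [h0, map_zero] at hne
  exact hne rfl

theorem eq_single_of_forall {f : TwistedAlgebra q B} {u : G}
    (h : ∀ v, coeff q B v f ≠ 0 → v = u) : f = single q B u (coeff q B u f) := by
  classical
  refine ext_coeff fun v => ?_
  rw [coeff_single]
  split_ifs with e
  · rw [e]
  · by_contra h'
    exact e (h v h').symm

/-- If `x` carries a monomial to `a`, then the support of `a` is bounded by that monomial. -/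
theorem le_of_mul_single_eq {x a : TwistedAlgebra q B} {h : G →+ Γ} (hh : Function.Injective h)
    (hx : x ≠ 0) {v w : G} {c : 𝕜} (e : x * single q B v c = a * x)
    (hw : coeff q B w a ≠ 0) : h w ≤ h v := by
  have ha : a ≠ 0 := by rintro rfl; simp at hw
  obtain ⟨u, u', -, -, hu, hu', hne⟩ := exists_top_mul hh ha hx
  rw [← e] at hne
  obtain ⟨s, t, hs, ht, est⟩ := exists_of_coeff_mul_ne_zero hne
  classical
  have htv : t = v := by
    by_contra h'
    exact ht (by rw [coeff_single, if_neg (Ne.symm h')])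
  subst htv
  have := congrArg h est
  rw [map_add, map_add] at this
  refine (hu w hw).trans ?_
  have h3 := hu' s hs
  by_contra! h4
  -- The top exponents of `a` and `x` add up to `s + v` with `s` in the support of `x`; as `s` is at
  -- most the top of `x`, the top of `a` is at most `v`.
  exact (add_lt_add_of_lt_of_le h4 h3).ne' (by rw [this, add_comm])

/-- An element that normalizes a monomial carries it to a multiple of itself. -/
theorem eq_single_of_mul_single_eq {x a : TwistedAlgebra q B} {h : G →+ Γ}
    (hh : Function.Injective h) (hx : x ≠ 0) {v : G} {c : 𝕜} (e : x * single q B v c = a * x) :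
    a = single q B v (coeff q B v a) := by
  refine eq_single_of_forall fun w hw => hh (le_antisymm (le_of_mul_single_eq hh hx e hw) ?_)
  -- Replacing `h` by `-h` reverses the order, so the same bound controls the lowest terms.
  have := le_of_mul_single_eq (h := -h) (fun s t hst => hh (neg_injective hst)) hx e hw
  simpa using this

/-- The units of the twisted algebra are the monomials. -/
theorem eq_single_of_mul_eq_one [Nontrivial (TwistedAlgebra q B)] {x y : TwistedAlgebra q B}
    {h : G →+ Γ} (hh : Function.Injective h) (e : x * y = 1) :
    ∃ u, ∃ a b : 𝕜, a ≠ 0 ∧ b ≠ 0 ∧ x = single q B u a ∧ y = single q B (-u) b := by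
  have hx : x ≠ 0 := by rintro rfl; simp at e
  have hy : y ≠ 0 := by rintro rfl; simp at e
  have supp_one : ∀ w, coeff q B w (x * y) ≠ 0 → w = 0 := fun w hw => by
    classical
    by_contra h'
    rw [e, one_def, coeff_single, if_neg (Ne.symm h')] at hw
    exact hw rfl
  obtain ⟨u, v, hu, hv, hu', hv', hne⟩ := exists_top_mul hh hx hy
  have hh' : Function.Injective (-h : G →+ Γ) := fun s t hst => hh (neg_injective hst)
  obtain ⟨s, t, hs, ht, hs', ht', hne'⟩ := exists_top_mul hh' hx hy
  have h1 : v = -u := (neg_eq_of_add_eq_zero_right (supp_one _ hne)).symm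
  have h2 : t = -s := (neg_eq_of_add_eq_zero_right (supp_one _ hne')).symm
  subst h1 h2
  -- The top exponents `u` of `x` and `-u` of `y` cancel, as do the lowest ones `s` and `-s`. Since
  -- `-s` occurs in `y`, it is at most `-u`, which gives `u ≤ s`: top and bottom coincide.
  have h3 : h u = h s := by
    refine le_antisymm ?_ (hu' s hs)
    simpa using hv' _ ht
  have hus : u = s := hh h3
  subst hus
  refine ⟨u, coeff q B u x, coeff q B (-u) y, hu, hv, eq_single_of_forall fun w hw => ?_,
    eq_single_of_forall fun w hw => ?_⟩
  · exact hh (le_antisymm (hu' w hw) (by simpa using hs' w hw))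
  · exact hh (le_antisymm (hv' w hw) (by
      have := ht' w hw
      simp only [AddMonoidHom.neg_apply, map_neg, neg_neg] at this ⊢
      exact neg_le.1 this))

end Order

/-- The commutation exponent with `v` of the monomials in the support of an element that commutes
with `single v r` up to a scalar is determined by the scalar. -/
theorem eq_zpow_of_mul_single_eq {x : TwistedAlgebra q B} {v : G} {c r : 𝕜} (hr : r ≠ 0)
    (e : x * single q B v r = c • (single q B v r * x)) {u : G} (hu : coeff q B u x ≠ 0) :
    c = ((q ^ (B u v - B v u) : 𝕜ˣ) : 𝕜) := by
  have h1 := congrArg (coeff q B (u + v)) e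
  rw [coeff_mul_single, map_smul, add_comm u v, coeff_single_mul, smul_eq_mul, mul_comm r,
    ← mul_assoc c] at h1
  have h2 := mul_right_cancel₀ (mul_ne_zero hu hr) h1
  rw [zpow_sub, Units.val_mul, h2, mul_assoc, ← Units.val_mul, mul_inv_cancel, Units.val_one,
    mul_one]

end

end TwistedAlgebra

/-! ### Relations, universal property and commutation with powers of `K` -/

namespace AgeingAlgebra

noncomputable section

section Relations

variable {𝕜 : Type*} [Field 𝕜] (q : 𝕜)

theorem Ku_inv_val : ((Ku q)⁻¹ : (AgeingAlgebra 𝕜 q)ˣ).val = gen q AgeingGen.Kinv := rfl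

theorem E_mul_Ku : E q * (Ku q : AgeingAlgebra 𝕜 q) =
    (q ^ 2)⁻¹ • ((Ku q : AgeingAlgebra 𝕜 q) * E q) := by
  simpa [E, Ku, gen] using RingQuot.mkAlgHom_rel 𝕜 (AgeingRel.E_mul_K (q := q))

theorem X_mul_Ku : X q * (Ku q : AgeingAlgebra 𝕜 q) =
    q⁻¹ • ((Ku q : AgeingAlgebra 𝕜 q) * X q) := by
  simpa [X, Ku, gen] using RingQuot.mkAlgHom_rel 𝕜 (AgeingRel.X_mul_K (q := q))

theorem Y_mul_Ku : Y q * (Ku q : AgeingAlgebra 𝕜 q) =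
    q • ((Ku q : AgeingAlgebra 𝕜 q) * Y q) := by
  simpa [Y, Ku, gen] using RingQuot.mkAlgHom_rel 𝕜 (AgeingRel.Y_mul_K (q := q))

theorem E_mul_X : E q * X q = q • (X q * E q) := by
  simpa [E, X, gen] using RingQuot.mkAlgHom_rel 𝕜 (AgeingRel.E_mul_X (q := q))

theorem E_mul_Y : E q * Y q = X q + q⁻¹ • (Y q * E q) := by
  simpa [E, X, Y, gen] using RingQuot.mkAlgHom_rel 𝕜 (AgeingRel.E_mul_Y (q := q))

theorem X_mul_Y : X q * Y q = q • (Y q * X q) := by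
  simpa [X, Y, gen] using (RingQuot.mkAlgHom_rel 𝕜 (AgeingRel.Y_mul_X (q := q))).symm

theorem phi_eq : phi q = X q + (q⁻¹ - q) • (Y q * E q) := by
  rw [phi, E_mul_Y]
  module

variable {q}

/-- The universal property of the ageing algebra. -/
def lift {R : Type*} [Ring R] [Algebra 𝕜 R] (e x y : R) (k : Rˣ)
    (ek : e * k = (q ^ 2)⁻¹ • (k * e)) (xk : x * k = q⁻¹ • (k * x)) (yk : y * k = q • (k * y))
    (ex : e * x = q • (x * e)) (ey : e * y = x + q⁻¹ • (y * e)) (yx : x * y = q • (y * x)) :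
    AgeingAlgebra 𝕜 q →ₐ[𝕜] R :=
  RingQuot.liftAlgHom 𝕜 ⟨FreeAlgebra.lift 𝕜 fun
    | AgeingGen.E => e
    | AgeingGen.K => k
    | AgeingGen.Kinv => (k⁻¹ : Rˣ)
    | AgeingGen.X => x
    | AgeingGen.Y => y, by
    intro a b h
    cases h <;> simp [ek, xk, yk, ex, ey, yx]⟩

section

variable {R : Type*} [Ring R] [Algebra 𝕜 R] {e x y : R} {k : Rˣ}
    {ek : e * k = (q ^ 2)⁻¹ • (k * e)} {xk : x * k = q⁻¹ • (k * x)} {yk : y * k = q • (k * y)}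
    {ex : e * x = q • (x * e)} {ey : e * y = x + q⁻¹ • (y * e)} {yx : x * y = q • (y * x)}

theorem lift_E : lift e x y k ek xk yk ex ey yx (E q) = e := by simp [lift, E, gen]

theorem lift_X : lift e x y k ek xk yk ex ey yx (X q) = x := by simp [lift, X, gen]

theorem lift_Y : lift e x y k ek xk yk ex ey yx (Y q) = y := by simp [lift, Y, gen]

theorem lift_Ku : lift e x y k ek xk yk ex ey yx (Ku q : AgeingAlgebra 𝕜 q) = k := by
  simp [lift, Ku, gen]

end

/-- The generator `K⁻¹` needs no hypothesis, since the image of an inverse is determined by the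
image of the unit. -/
theorem algHom_ext {R : Type*} [Ring R] [Algebra 𝕜 R] {f g : AgeingAlgebra 𝕜 q →ₐ[𝕜] R}
    (hE : f (E q) = g (E q)) (hX : f (X q) = g (X q)) (hY : f (Y q) = g (Y q))
    (hK : f (Ku q : AgeingAlgebra 𝕜 q) = g (Ku q : AgeingAlgebra 𝕜 q)) : f = g := by
  have hK' : Units.map (f : AgeingAlgebra 𝕜 q →* R) (Ku q) =
      Units.map (g : AgeingAlgebra 𝕜 q →* R) (Ku q) :=
    Units.ext hK
  have hKi : f (gen q AgeingGen.Kinv) = g (gen q AgeingGen.Kinv) := by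
    have := congrArg (fun u : Rˣ => ((u⁻¹ : Rˣ) : R)) hK'
    simpa [← map_inv, Ku_inv_val] using this
  refine RingQuot.ringQuot_ext' 𝕜 f g (FreeAlgebra.hom_ext (funext fun i => ?_))
  cases i
  exacts [hE, hK, hKi, hX, hY]

end Relations

section Commutation

variable {𝕜 R : Type*} [Field 𝕜] [Ring R] [Algebra 𝕜 R]

/-- An element that commutes with a unit up to a scalar commutes with its powers up to the
powers of the scalar. -/
theorem mul_zpow_eq_smul {a : R} {u : Rˣ} {c : 𝕜ˣ} (h : a * u = (c : 𝕜) • ((u : R) * a)) (n : ℤ) :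
    a * (u ^ n : Rˣ) = ((c ^ n : 𝕜ˣ) : 𝕜) • (((u ^ n : Rˣ) : R) * a) := by
  set d : Rˣ := Units.map (algebraMap 𝕜 R : 𝕜 →* R) c with hd
  have hc : Commute d u := Units.ext (Algebra.commutes (c : 𝕜) (u : R))
  have h1 : SemiconjBy a (u : R) ((d * u : Rˣ) : R) := by
    simpa [SemiconjBy, hd, Algebra.smul_def, mul_assoc] using h
  have h2 := SemiconjBy.units_zpow_right h1 n
  rw [hc.mul_zpow, hd, ← map_zpow] at h2
  rw [Algebra.smul_def, ← mul_assoc]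
  exact h2

end Commutation

variable {𝕜 : Type*} [Field 𝕜] (q : 𝕜ˣ)

theorem E_mul_Kpow (n : ℤ) :
    E (q : 𝕜) * Kpow (q : 𝕜) n = ((q ^ (-2 * n) : 𝕜ˣ) : 𝕜) • (Kpow (q : 𝕜) n * E (q : 𝕜)) := by
  rw [zpow_mul]
  exact mul_zpow_eq_smul (by simpa [zpow_ofNat] using E_mul_Ku (q : 𝕜)) n

theorem X_mul_Kpow (n : ℤ) :
    X (q : 𝕜) * Kpow (q : 𝕜) n = ((q ^ (-n) : 𝕜ˣ) : 𝕜) • (Kpow (q : 𝕜) n * X (q : 𝕜)) := by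
  rw [zpow_neg, ← inv_zpow]
  exact mul_zpow_eq_smul (by simpa using X_mul_Ku (q : 𝕜)) n

theorem Y_mul_Kpow (n : ℤ) :
    Y (q : 𝕜) * Kpow (q : 𝕜) n = ((q ^ n : 𝕜ˣ) : 𝕜) • (Kpow (q : 𝕜) n * Y (q : 𝕜)) :=
  mul_zpow_eq_smul (Y_mul_Ku (q : 𝕜)) n

theorem Kpow_add (m n : ℤ) : Kpow (q : 𝕜) (m + n) = Kpow (q : 𝕜) m * Kpow (q : 𝕜) n := by
  simp [Kpow, zpow_add]

theorem Kpow_zero : Kpow (q : 𝕜) 0 = 1 := by simp [Kpow]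

theorem Kpow_one : Kpow (q : 𝕜) 1 = (Ku (q : 𝕜) : AgeingAlgebra 𝕜 (q : 𝕜)) := by simp [Kpow]

end

end AgeingAlgebra

/-! ### Ordered monomials span the algebra -/

namespace AgeingAlgebra

noncomputable section

section Span

variable {𝕜 : Type*} [Field 𝕜] (q : 𝕜ˣ)

theorem mul_pow_eq_smul {R : Type*} [Ring R] [Algebra 𝕜 R] {a u : R} {c : 𝕜}
    (h : a * u = c • (u * a)) (n : ℕ) : a * u ^ n = c ^ n • (u ^ n * a) := by
  induction n with
  | zero => simp
  | succ n ih =>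
    rw [pow_succ, ← mul_assoc, ih, smul_mul_assoc, mul_assoc, h, mul_smul_comm, smul_smul,
      mul_assoc, pow_succ]

theorem Y_mul_X : Y (q : 𝕜) * X (q : 𝕜) = (q : 𝕜)⁻¹ • (X (q : 𝕜) * Y (q : 𝕜)) := by
  rw [X_mul_Y, smul_smul, inv_mul_cancel₀ q.ne_zero, one_smul]

/-- Moving `E` through `Y ^ b` creates only multiples of one correction term, because `X` commutes
with `Y` up to a scalar. The scalars are irrelevant for spanning; at `b = 0` the truncated exponent
is harmless because `d = 0`. -/
theorem exists_E_mul_Y_pow (b : ℕ) : ∃ c d : 𝕜, E (q : 𝕜) * Y (q : 𝕜) ^ b =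
    c • (Y (q : 𝕜) ^ b * E (q : 𝕜)) + d • (X (q : 𝕜) * Y (q : 𝕜) ^ (b - 1)) := by
  induction b with
  | zero => exact ⟨1, 0, by simp⟩
  | succ b ih =>
    obtain ⟨c, d, h⟩ := ih
    have hX : ∃ r : 𝕜, Y (q : 𝕜) ^ b * X (q : 𝕜) = r • (X (q : 𝕜) * Y (q : 𝕜) ^ b) := by
      refine ⟨((q : 𝕜) ^ b)⁻¹, ?_⟩
      rw [mul_pow_eq_smul (X_mul_Y (q : 𝕜)), smul_smul, inv_mul_cancel₀, one_smul]
      exact pow_ne_zero _ q.ne_zero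
    obtain ⟨r, hr⟩ := hX
    rcases Nat.eq_zero_or_pos b with rfl | hb
    · exact ⟨(q : 𝕜)⁻¹, 1, by simp [E_mul_Y, add_comm]⟩
    · obtain ⟨b, rfl⟩ := Nat.exists_eq_succ_of_ne_zero hb.ne'
      refine ⟨c * (q : 𝕜)⁻¹, c * r + d, ?_⟩
      rw [pow_succ, ← mul_assoc, h, add_mul, smul_mul_assoc, mul_assoc, E_mul_Y, mul_add, hr,
        mul_smul_comm, smul_mul_assoc, smul_add, smul_smul, smul_smul, add_smul,
        mul_assoc (X (q : 𝕜)), ← mul_assoc (Y (q : 𝕜) ^ _)]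
      simp only [Nat.succ_eq_add_one, Nat.add_sub_cancel, ← pow_succ]
      abel

/-- The ordered monomials in the generators. -/
def pbw (k : ℤ) (i b c : ℕ) : AgeingAlgebra 𝕜 (q : 𝕜) :=
  Kpow (q : 𝕜) k * X (q : 𝕜) ^ i * Y (q : 𝕜) ^ b * E (q : 𝕜) ^ c

/-- The span of the ordered monomials. -/
def pbwSpan : Submodule 𝕜 (AgeingAlgebra 𝕜 (q : 𝕜)) :=
  Submodule.span 𝕜 {a | ∃ k i b c, a = pbw q k i b c}

theorem pbw_mem (k : ℤ) (i b c : ℕ) : pbw q k i b c ∈ pbwSpan q :=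
  Submodule.subset_span ⟨k, i, b, c, rfl⟩

theorem mul_mem_pbwSpan {g : AgeingAlgebra 𝕜 (q : 𝕜)}
    (h : ∀ k i b c, g * pbw q k i b c ∈ pbwSpan q) {s : AgeingAlgebra 𝕜 (q : 𝕜)}
    (hs : s ∈ pbwSpan q) : g * s ∈ pbwSpan q := by
  induction hs using Submodule.span_induction with
  | mem x hx =>
    obtain ⟨k, i, b, c, rfl⟩ := hx
    exact h k i b c
  | zero => simp
  | add x y _ _ hx hy => rw [mul_add]; exact add_mem hx hy
  | smul r x _ hx => rw [mul_smul_comm]; exact Submodule.smul_mem _ _ hx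

theorem Kpow_mul_pbw (n k : ℤ) (i b c : ℕ) :
    Kpow (q : 𝕜) n * pbw q k i b c = pbw q (n + k) i b c := by
  simp only [pbw, Kpow_add, mul_assoc]

theorem X_mul_pbw (k : ℤ) (i b c : ℕ) :
    X (q : 𝕜) * pbw q k i b c = ((q ^ (-k) : 𝕜ˣ) : 𝕜) • pbw q k (i + 1) b c := by
  simp only [pbw, ← mul_assoc, X_mul_Kpow, smul_mul_assoc, pow_succ']

theorem Y_mul_pbw (k : ℤ) (i b c : ℕ) :
    Y (q : 𝕜) * pbw q k i b c =
      (((q ^ k : 𝕜ˣ) : 𝕜) * ((q : 𝕜)⁻¹) ^ i) • pbw q k i (b + 1) c := by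
  simp only [pbw, ← mul_assoc, Y_mul_Kpow, smul_mul_assoc]
  rw [mul_assoc (Kpow (q : 𝕜) k), mul_pow_eq_smul (Y_mul_X q), mul_smul_comm]
  simp only [smul_mul_assoc, smul_smul, mul_assoc, pow_succ']

theorem E_mul_pbw_mem (k : ℤ) (i b c : ℕ) : E (q : 𝕜) * pbw q k i b c ∈ pbwSpan q := by
  obtain ⟨r, d, h⟩ := exists_E_mul_Y_pow q b
  have hY : X (q : 𝕜) ^ i * X (q : 𝕜) = X (q : 𝕜) ^ (i + 1) := (pow_succ _ _).symm
  have : E (q : 𝕜) * pbw q k i b c = (((q ^ (-2 * k) : 𝕜ˣ) : 𝕜) * (q : 𝕜) ^ i) •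
      (r • pbw q k i b (c + 1) + d • pbw q k (i + 1) (b - 1) c) := by
    simp only [pbw, ← mul_assoc, E_mul_Kpow, smul_mul_assoc]
    rw [mul_assoc (Kpow (q : 𝕜) k), mul_pow_eq_smul (E_mul_X (q : 𝕜)), mul_smul_comm]
    simp only [smul_mul_assoc, smul_smul, mul_assoc]
    rw [← mul_assoc (E (q : 𝕜)) (Y (q : 𝕜) ^ b), h]
    simp only [add_mul, mul_add, smul_mul_assoc, mul_smul_comm, smul_add, ← hY, pow_succ' (E _),
      mul_assoc]
  rw [this]
  exact Submodule.smul_mem _ _ (add_mem (Submodule.smul_mem _ _ (pbw_mem _ _ _ _ _))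
    (Submodule.smul_mem _ _ (pbw_mem _ _ _ _ _)))

/-- The span contains `1` and is stable under left multiplication by each generator, hence is a left
ideal containing `1`. -/
theorem mem_pbwSpan (a : AgeingAlgebra 𝕜 (q : 𝕜)) : a ∈ pbwSpan q := by
  have key : ∀ a : AgeingAlgebra 𝕜 (q : 𝕜), ∀ s ∈ pbwSpan q, a * s ∈ pbwSpan q := by
    intro a
    obtain ⟨f, rfl⟩ := RingQuot.mkAlgHom_surjective 𝕜 (AgeingRel (q : 𝕜)) a
    induction f using FreeAlgebra.induction with
    | grade0 r =>
      intro s hs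
      rw [AlgHom.commutes, ← Algebra.smul_def]
      exact Submodule.smul_mem _ _ hs
    | grade1 g =>
      intro s hs
      refine mul_mem_pbwSpan q (fun k i b c => ?_) hs
      cases g with
      | E => exact E_mul_pbw_mem q k i b c
      | K =>
        have h := Kpow_mul_pbw q 1 k i b c
        rw [Kpow_one] at h
        exact (congrArg (· ∈ pbwSpan q) h).mpr (pbw_mem _ _ _ _ _)
      | Kinv =>
        have h := Kpow_mul_pbw q (-1) k i b c
        rw [Kpow, zpow_neg_one] at h
        exact (congrArg (· ∈ pbwSpan q) h).mpr (pbw_mem _ _ _ _ _)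
      | X =>
        exact (congrArg (· ∈ pbwSpan q) (X_mul_pbw q k i b c)).mpr
          (Submodule.smul_mem _ _ (pbw_mem _ _ _ _ _))
      | Y =>
        exact (congrArg (· ∈ pbwSpan q) (Y_mul_pbw q k i b c)).mpr
          (Submodule.smul_mem _ _ (pbw_mem _ _ _ _ _))
    | mul f g hf hg =>
      intro s hs
      rw [map_mul, mul_assoc]
      exact hf _ (hg _ hs)
    | add f g hf hg =>
      intro s hs
      rw [map_add, add_mul]
      exact add_mem (hf _ hs) (hg _ hs)
  have h1 : (1 : AgeingAlgebra 𝕜 (q : 𝕜)) = pbw q 0 0 0 0 := by simp [pbw, Kpow_zero]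
  have := key a 1 (h1 ▸ pbw_mem q 0 0 0 0)
  rwa [mul_one] at this

end Span

end

end AgeingAlgebra

/-! ### The quantum torus and the map into it -/

namespace AgeingAlgebra

noncomputable section

/-- The commutation form of the quantum torus generated by `Y, K, X, φ` (in this order of
coordinates), for the normal ordering `K ^ k * X ^ i * φ ^ j * Y ^ b` of the monomials. -/
def torusForm : ℤ × ℤ × ℤ × ℤ →+ ℤ × ℤ × ℤ × ℤ →+ ℤ :=
  AddMonoidHom.mk' (fun u => AddMonoidHom.mk' (fun v => u.1 * v.2.1 - u.1 * v.2.2.1 +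
    u.1 * v.2.2.2 - u.2.2.2 * v.2.1 - u.2.2.1 * v.2.1) (fun v w => by simp; ring))
    (fun u v => by
      refine AddMonoidHom.ext fun w => ?_
      simp only [AddMonoidHom.mk'_apply, AddMonoidHom.add_apply, Prod.fst_add, Prod.snd_add]
      ring)

theorem torusForm_apply (b k i j b' k' i' j' : ℤ) :
    torusForm (b, k, i, j) (b', k', i', j') = b * k' - b * i' + b * j' - j * k' - i * k' := rfl

variable {𝕜 : Type*} [Field 𝕜] (q : 𝕜ˣ)

/-- The quantum torus generated by `Y, K, X, φ`. -/
abbrev Torus : Type _ := TwistedAlgebra q torusForm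

/-- The monomial `a • K ^ k * X ^ i * φ ^ j * Y ^ b` of the quantum torus. -/
abbrev mono (b k i j : ℤ) (a : 𝕜) : Torus q := TwistedAlgebra.single q torusForm (b, k, i, j) a

/-- The coefficient of `K ^ k * X ^ i * φ ^ j * Y ^ b`. -/
abbrev cf (b k i j : ℤ) : Torus q →ₗ[𝕜] 𝕜 := TwistedAlgebra.coeff q torusForm (b, k, i, j)

theorem mono_mul_mono (b k i j b' k' i' j' : ℤ) (a a' : 𝕜) :
    mono q b k i j a * mono q b' k' i' j' a' =
      mono q (b + b') (k + k') (i + i') (j + j')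
        ((q : 𝕜) ^ (b * k' - b * i' + b * j' - j * k' - i * k') * (a * a')) := by
  rw [TwistedAlgebra.single_mul_single, torusForm_apply, Units.val_zpow_eq_zpow_val]
  rfl

theorem smul_mono (b k i j : ℤ) (r a : 𝕜) : r • mono q b k i j a = mono q b k i j (r * a) :=
  TwistedAlgebra.smul_single _ _ _

theorem mono_add (b k i j : ℤ) (r a : 𝕜) :
    mono q b k i j (r + a) = mono q b k i j r + mono q b k i j a :=
  Finsupp.single_add _ _ _

theorem one_eq_mono : (1 : Torus q) = mono q 0 0 0 0 1 := rfl

/-- `K` as a unit of the quantum torus. -/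
def torusK : (Torus q)ˣ where
  val := mono q 0 1 0 0 1
  inv := mono q 0 (-1) 0 0 1
  val_inv := by rw [mono_mul_mono]; simp [one_eq_mono]
  inv_val := by rw [mono_mul_mono]; simp [one_eq_mono]

theorem torusK_zpow (n : ℤ) : ((torusK q ^ n : (Torus q)ˣ) : Torus q) = mono q 0 n 0 0 1 := by
  induction n using Int.induction_on with
  | zero => simp [one_eq_mono]
  | succ n ih =>
    rw [zpow_add_one, Units.val_mul, ih]
    exact (mono_mul_mono ..).trans (by simp)
  | pred n ih =>
    rw [zpow_sub_one, Units.val_mul, ih]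
    exact (mono_mul_mono ..).trans (by simp; rfl)

variable {q} (h2 : (q : 𝕜)⁻¹ - q ≠ 0)

/-- The image of `E` in the quantum torus, for which `Y * E = (q⁻¹ - q)⁻¹ • (φ - X)`. -/
def torusE (q : 𝕜ˣ) : Torus q :=
  mono q (-1) 0 0 1 (((q : 𝕜)⁻¹ - q)⁻¹ * (q : 𝕜)⁻¹) - mono q (-1) 0 1 0 (((q : 𝕜)⁻¹ - q)⁻¹ * q)

include h2 in
-- This is the only defining relation that is not a commutation up to a scalar. In the relations of
-- `E` with `K` and with `X`, the two monomials of `torusE` have the same commutation exponents.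
theorem torusE_mul_Y :
    torusE q * mono q 1 0 0 0 1 = mono q 0 0 1 0 1 + (q : 𝕜)⁻¹ • (mono q 1 0 0 0 1 * torusE q) := by
  have hq := q.ne_zero
  simp only [torusE, sub_mul, mul_sub, mono_mul_mono]
  norm_num
  -- The coefficients of `X` on the two sides differ by `(q⁻¹ - q)⁻¹ (q⁻¹ - q) = 1`, which is the
  -- extra summand `X`; by `h3` the coefficients of `φ` agree.
  have h1 : (q : 𝕜)⁻¹ * ((q : 𝕜)⁻¹ * (((q : 𝕜)⁻¹ - q)⁻¹ * q)) = 1 + ((q : 𝕜)⁻¹ - q)⁻¹ * q := by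
    rw [← mul_inv_cancel₀ h2]
    field_simp
    ring
  have h3 : (q : 𝕜)⁻¹ * (q * (((q : 𝕜)⁻¹ - q)⁻¹ * (q : 𝕜)⁻¹)) = ((q : 𝕜)⁻¹ - q)⁻¹ * (q : 𝕜)⁻¹ :=
    inv_mul_cancel_left₀ hq _
  rw [smul_sub, smul_mono, smul_mono, h1, h3, mono_add]
  abel

/-- The map from the ageing algebra to the quantum torus. -/
def toTorus : AgeingAlgebra 𝕜 (q : 𝕜) →ₐ[𝕜] Torus q :=
  lift (torusE q) (mono q 0 0 1 0 1) (mono q 1 0 0 0 1) (torusK q)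
    (by
      have hq := q.ne_zero
      simp only [torusE, torusK, sub_mul, mul_sub, mono_mul_mono, smul_sub, smul_mono]
      norm_num)
    (by
      simp only [torusK, mono_mul_mono, smul_mono]
      norm_num)
    (by
      simp only [torusK, mono_mul_mono, smul_mono]
      norm_num)
    (by
      have hq := q.ne_zero
      simp only [torusE, sub_mul, mul_sub, mono_mul_mono, smul_sub, smul_mono]
      norm_num)
    (torusE_mul_Y h2)
    (by
      simp only [mono_mul_mono, smul_mono]
      norm_num)

theorem toTorus_E : toTorus h2 (E (q : 𝕜)) = torusE q := lift_E

theorem toTorus_X : toTorus h2 (X (q : 𝕜)) = mono q 0 0 1 0 1 := lift_X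

theorem toTorus_Y : toTorus h2 (Y (q : 𝕜)) = mono q 1 0 0 0 1 := lift_Y

theorem toTorus_Ku : toTorus h2 (Ku (q : 𝕜) : AgeingAlgebra 𝕜 (q : 𝕜)) = mono q 0 1 0 0 1 :=
  lift_Ku

theorem toTorus_Kpow (n : ℤ) : toTorus h2 (Kpow (q : 𝕜) n) = mono q 0 n 0 0 1 := by
  have h : Units.map (toTorus h2 : AgeingAlgebra 𝕜 (q : 𝕜) →* Torus q) (Ku (q : 𝕜)) = torusK q :=
    Units.ext (toTorus_Ku h2)
  rw [← torusK_zpow, ← h, ← map_zpow]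
  rfl

theorem mono_Y_mul_torusE : mono q 1 0 0 0 1 * torusE q =
    ((q : 𝕜)⁻¹ - q)⁻¹ • (mono q 0 0 0 1 1 - mono q 0 0 1 0 1) := by
  have hq := q.ne_zero
  simp only [torusE, mul_sub, mono_mul_mono, smul_sub, smul_mono]
  norm_num
  congr 2 <;> field_simp

theorem toTorus_phi : toTorus h2 (phi (q : 𝕜)) = mono q 0 0 0 1 1 := by
  rw [phi_eq, map_add, map_smul, map_mul, toTorus_X, toTorus_Y, toTorus_E, mono_Y_mul_torusE,
    smul_smul, mul_inv_cancel₀ h2, one_smul]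
  abel

theorem cf_mono_same (b k i j : ℤ) (a : 𝕜) : cf q b k i j (mono q b k i j a) = a :=
  TwistedAlgebra.coeff_single_same _ _

theorem eq_of_cf_mono_ne_zero {b k i j b' k' i' j' : ℤ} {a : 𝕜}
    (h : cf q b k i j (mono q b' k' i' j' a) ≠ 0) : b = b' ∧ k = k' ∧ i = i' ∧ j = j' := by
  rw [TwistedAlgebra.coeff_single] at h
  have := (ite_ne_right_iff.1 h).1
  simp only [Prod.mk.injEq] at this
  omega

theorem exists_of_cf_mul_ne_zero {f g : Torus q} {b k i j : ℤ} (h : cf q b k i j (f * g) ≠ 0) :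
    ∃ b₁ k₁ i₁ j₁ b₂ k₂ i₂ j₂, cf q b₁ k₁ i₁ j₁ f ≠ 0 ∧ cf q b₂ k₂ i₂ j₂ g ≠ 0 ∧
      b = b₁ + b₂ ∧ k = k₁ + k₂ ∧ i = i₁ + i₂ ∧ j = j₁ + j₂ := by
  obtain ⟨⟨b₁, k₁, i₁, j₁⟩, ⟨b₂, k₂, i₂, j₂⟩, h1, h2, e⟩ :=
    TwistedAlgebra.exists_of_coeff_mul_ne_zero h
  simp only [Prod.mk_add_mk, Prod.mk.injEq] at e
  exact ⟨b₁, k₁, i₁, j₁, b₂, k₂, i₂, j₂, h1, h2, e⟩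

theorem cf_torusE {b k i j : ℤ} (h : cf q b k i j (torusE q) ≠ 0) :
    b = -1 ∧ k = 0 ∧ (i = 0 ∧ j = 1 ∨ i = 1 ∧ j = 0) := by
  by_contra h'
  apply h
  rw [torusE, map_sub]
  by_cases h1 : cf q b k i j (mono q (-1) 0 0 1 (((q : 𝕜)⁻¹ - q)⁻¹ * (q : 𝕜)⁻¹)) = 0
  · by_cases h2 : cf q b k i j (mono q (-1) 0 1 0 (((q : 𝕜)⁻¹ - q)⁻¹ * q)) = 0
    · rw [h1, h2, sub_zero]
    · have := eq_of_cf_mono_ne_zero h2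
      omega
  · have := eq_of_cf_mono_ne_zero h1
    omega

theorem cf_torusE_pow {c : ℕ} {b k i j : ℤ} (h : cf q b k i j (torusE q ^ c) ≠ 0) :
    b = -c ∧ k = 0 ∧ 0 ≤ i ∧ 0 ≤ j ∧ i + j = c := by
  induction c generalizing b k i j with
  | zero =>
    rw [pow_zero, one_eq_mono] at h
    have := eq_of_cf_mono_ne_zero h
    omega
  | succ c ih =>
    rw [pow_succ] at h
    obtain ⟨b₁, k₁, i₁, j₁, b₂, k₂, i₂, j₂, h1, h2, h3⟩ := exists_of_cf_mul_ne_zero h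
    have h4 := ih h1
    have h5 := cf_torusE h2
    push_cast
    omega

theorem cf_mul_mono (b k i j b' k' i' j' : ℤ) (a : 𝕜) (f : Torus q) :
    cf q (b + b') (k + k') (i + i') (j + j') (f * mono q b' k' i' j' a) =
      (q : 𝕜) ^ (b * k' - b * i' + b * j' - j * k' - i * k') * (cf q b k i j f * a) := by
  have := TwistedAlgebra.coeff_mul_single (q := q) (B := torusForm) (b', k', i', j') (b, k, i, j) a f
  rwa [torusForm_apply, Units.val_zpow_eq_zpow_val] at this

theorem cf_mono_mul (b k i j b' k' i' j' : ℤ) (a : 𝕜) (f : Torus q) :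
    cf q (b + b') (k + k') (i + i') (j + j') (mono q b k i j a * f) =
      (q : 𝕜) ^ (b * k' - b * i' + b * j' - j * k' - i * k') * (a * cf q b' k' i' j' f) := by
  have := TwistedAlgebra.coeff_single_mul (q := q) (B := torusForm) (b, k, i, j) (b', k', i', j') a f
  rwa [torusForm_apply, Units.val_zpow_eq_zpow_val] at this

include h2 in
theorem cf_torusE_pow_ne_zero (c : ℕ) : cf q (-c) 0 0 c (torusE q ^ c) ≠ 0 := by
  induction c with
  | zero =>
    rw [pow_zero, one_eq_mono]
    simp [cf_mono_same]
  | succ c ih =>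
    -- To reach `X`-degree 0 with a last factor `X Y⁻¹`, the power `torusE q ^ c` would need
    -- `X`-degree `-1`. So only the `φ Y⁻¹` term of each factor contributes.
    have h0 : cf q (-c) 0 (-1) (c + 1) (torusE q ^ c) = 0 := by
      by_contra h
      have := cf_torusE_pow h
      omega
    have h3 := cf_mul_mono (-c) 0 0 c (-1) 0 0 1 (((q : 𝕜)⁻¹ - q)⁻¹ * (q : 𝕜)⁻¹) (torusE q ^ c)
    have h4 := cf_mul_mono (-c) 0 (-1) (c + 1) (-1) 0 1 0 (((q : 𝕜)⁻¹ - q)⁻¹ * (q : 𝕜)) (torusE q ^ c)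
    rw [h0, zero_mul, mul_zero] at h4
    have h5 : cf q (-(c + 1 : ℕ)) 0 0 (c + 1 : ℕ) (torusE q ^ (c + 1)) =
        cf q (-c + -1) (0 + 0) (0 + 0) (c + 1)
          (torusE q ^ c * mono q (-1) 0 0 1 (((q : 𝕜)⁻¹ - q)⁻¹ * (q : 𝕜)⁻¹)) -
        cf q (-c + -1) (0 + 0) (-1 + 1) (c + 1 + 0)
          (torusE q ^ c * mono q (-1) 0 1 0 (((q : 𝕜)⁻¹ - q)⁻¹ * (q : 𝕜))) := by
      rw [pow_succ, torusE.eq_1, mul_sub, map_sub]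
      push_cast
      simp only [neg_add, add_zero]
    rw [h5, h3, h4, sub_zero]
    exact mul_ne_zero (zpow_ne_zero _ q.ne_zero)
      (mul_ne_zero ih (mul_ne_zero (inv_ne_zero h2) (inv_ne_zero q.ne_zero)))

end

end AgeingAlgebra

/-! ### Injectivity of the map to the torus and constraints on its image -/

namespace AgeingAlgebra

noncomputable section

variable {𝕜 : Type*} [Field 𝕜] {q : 𝕜ˣ} (h2 : (q : 𝕜)⁻¹ - q ≠ 0)

theorem mono_X_pow (n : ℕ) : mono q 0 0 1 0 1 ^ n = mono q 0 0 n 0 1 := by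
  induction n with
  | zero => simp [one_eq_mono]
  | succ n ih => rw [pow_succ, ih, mono_mul_mono]; simp

theorem mono_Y_pow (n : ℕ) : mono q 1 0 0 0 1 ^ n = mono q n 0 0 0 1 := by
  induction n with
  | zero => simp [one_eq_mono]
  | succ n ih => rw [pow_succ, ih, mono_mul_mono]; simp

theorem toTorus_pbw (k : ℤ) (i b c : ℕ) :
    toTorus h2 (pbw q k i b c) = mono q b k i 0 1 * torusE q ^ c := by
  simp only [pbw, map_mul, map_pow, toTorus_E, toTorus_X, toTorus_Y, toTorus_Kpow, mono_X_pow,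
    mono_Y_pow, mono_mul_mono]
  simp

theorem cf_toTorus_pbw {k : ℤ} {i b c : ℕ} {b' k' i' j' : ℤ}
    (h : cf q b' k' i' j' (toTorus h2 (pbw q k i b c)) ≠ 0) :
    b' = b - c ∧ k' = k ∧ i ≤ i' ∧ 0 ≤ j' ∧ i' + j' = i + c := by
  rw [toTorus_pbw] at h
  obtain ⟨b₁, k₁, i₁, j₁, b₂, k₂, i₂, j₂, h3, h4, h5⟩ := exists_of_cf_mul_ne_zero h
  have h6 := eq_of_cf_mono_ne_zero h3
  have h7 := cf_torusE_pow h4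
  omega

theorem cf_toTorus_pbw_ne_zero (k : ℤ) (i b c : ℕ) :
    cf q (b - c) k i c (toTorus h2 (pbw q k i b c)) ≠ 0 := by
  have h := cf_mono_mul b k i 0 (-c) 0 0 c 1 (torusE q ^ c)
  rw [← toTorus_pbw h2, ← sub_eq_add_neg, add_zero, add_zero, zero_add] at h
  rw [h]
  exact mul_ne_zero (zpow_ne_zero _ q.ne_zero) (mul_ne_zero one_ne_zero (cf_torusE_pow_ne_zero h2 c))

/-- A linear map that vanishes on the ordered monomials vanishes. -/
theorem linearMap_eq_zero {M : Type*} [AddCommGroup M] [Module 𝕜 M]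
    (f : AgeingAlgebra 𝕜 (q : 𝕜) →ₗ[𝕜] M) (h : ∀ k i b c, f (pbw q k i b c) = 0)
    (a : AgeingAlgebra 𝕜 (q : 𝕜)) : f a = 0 := by
  have : pbwSpan q ≤ LinearMap.ker f :=
    Submodule.span_le.2 (by rintro _ ⟨k, i, b, c, rfl⟩; exact h k i b c)
  exact this (mem_pbwSpan q a)

/-- Take a monomial of maximal `E`-degree `c` in a linear relation and read off the exponent of `K ^
k * X ^ i * φ ^ c * Y ^ (b - c)`. By `cf_toTorus_pbw`, another monomial contributing there with `c'
≤ c` must have `i' ≤ i` and `i' + c' = i + c`, hence be the same monomial. -/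
theorem toTorus_injective : Function.Injective (toTorus h2) := by
  classical
  rw [injective_iff_map_eq_zero]
  intro a ha
  have hspan : a ∈ Submodule.span 𝕜
      (Set.range fun m : ℤ × ℕ × ℕ × ℕ => pbw q m.1 m.2.1 m.2.2.1 m.2.2.2) := by
    refine Submodule.span_mono ?_ (mem_pbwSpan q a)
    rintro _ ⟨k, i, b, c, rfl⟩
    exact ⟨(k, i, b, c), rfl⟩
  obtain ⟨f, rfl⟩ := Finsupp.mem_span_range_iff_exists_finsupp.1 hspan
  by_cases hf : f = 0
  · simp [hf]
  obtain ⟨⟨k, i, b, c⟩, hm, hmax⟩ := Finset.exists_max_image f.support (fun m => m.2.2.2)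
    (Finsupp.support_nonempty_iff.2 hf)
  exfalso
  have h := congrArg (cf q (b - c) k i c) ha
  rw [Finsupp.sum, map_sum, map_sum, map_zero, Finset.sum_eq_single (k, i, b, c)] at h
  · rw [map_smul, map_smul, smul_eq_mul] at h
    exact mul_ne_zero (Finsupp.mem_support_iff.1 hm) (cf_toTorus_pbw_ne_zero h2 k i b c) h
  · rintro ⟨k', i', b', c'⟩ hm' hne
    rw [map_smul, map_smul]
    by_contra h'
    have h3 := cf_toTorus_pbw h2 (k := k') (i := i') (b := b') (c := c') (right_ne_zero_of_mul h')
    have h4 : c' ≤ c := hmax _ hm'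
    apply hne
    simp only [Prod.mk.injEq]
    omega
  · exact fun h' => absurd hm h'

theorem exists_pbw_of_cf_ne_zero {a : AgeingAlgebra 𝕜 (q : 𝕜)} {b k i j : ℤ}
    (h : cf q b k i j (toTorus h2 a) ≠ 0) :
    ∃ k' i' b' c', cf q b k i j (toTorus h2 (pbw q k' i' b' c')) ≠ 0 := by
  by_contra! h'
  exact h (linearMap_eq_zero (cf q b k i j ∘ₗ (toTorus h2).toLinearMap) h' a)

/-- For the image of an ordered monomial, `i + j + b` is its degree in `X` plus its degree in `Y`: a
factor `E` changes `i + j` by 1 and `b` by -1. These inequalities say how far negative powers of `Y`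
can occur in the image. -/
theorem nonneg_of_cf_ne_zero {a : AgeingAlgebra 𝕜 (q : 𝕜)} {b k i j : ℤ}
    (h : cf q b k i j (toTorus h2 a) ≠ 0) : 0 ≤ i ∧ 0 ≤ j ∧ 0 ≤ i + j + b := by
  obtain ⟨k', i', b', c', h'⟩ := exists_pbw_of_cf_ne_zero h2 h
  have := cf_toTorus_pbw h2 h'
  omega

/-- The linear relation between the coefficients of `φ` and `X` in the right ideal of `Y`. -/
theorem cf_Y_mul (z : AgeingAlgebra 𝕜 (q : 𝕜)) :
    cf q 0 0 0 1 (toTorus h2 (Y (q : 𝕜) * z)) + cf q 0 0 1 0 (toTorus h2 (Y (q : 𝕜) * z)) = 0 := by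
  refine linearMap_eq_zero ((cf q 0 0 0 1 + cf q 0 0 1 0) ∘ₗ (toTorus h2).toLinearMap ∘ₗ
    LinearMap.mulLeft 𝕜 (Y (q : 𝕜))) (fun k i b c => ?_) z
  change cf q 0 0 0 1 (toTorus h2 (Y (q : 𝕜) * pbw q k i b c)) +
    cf q 0 0 1 0 (toTorus h2 (Y (q : 𝕜) * pbw q k i b c)) = 0
  -- Left multiplication by `Y` sends ordered monomials to multiples of ordered monomials with a
  -- factor `Y`, and among these only `Y E` has `φ` or `X` in its support.
  by_cases h : k = 0 ∧ i = 0 ∧ b = 0 ∧ c = 1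
  · obtain ⟨rfl, rfl, rfl, rfl⟩ := h
    have : Y (q : 𝕜) * pbw q 0 0 0 1 = Y (q : 𝕜) * E (q : 𝕜) := by simp [pbw, Kpow_zero]
    rw [this, map_mul, toTorus_Y, toTorus_E, mono_Y_mul_torusE]
    simp only [map_smul, map_sub, cf_mono_same]
    have h1 : cf q 0 0 0 1 (mono q 0 0 1 0 1) = 0 := by
      by_contra h; have := eq_of_cf_mono_ne_zero h; omega
    have h3 : cf q 0 0 1 0 (mono q 0 0 0 1 1) = 0 := by
      by_contra h; have := eq_of_cf_mono_ne_zero h; omega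
    simp [h1, h3]
  · rw [Y_mul_pbw, map_smul, map_smul, map_smul, ← smul_add]
    have h1 : cf q 0 0 0 1 (toTorus h2 (pbw q k i (b + 1) c)) = 0 := by
      by_contra h; have := cf_toTorus_pbw h2 h; omega
    have h3 : cf q 0 0 1 0 (toTorus h2 (pbw q k i (b + 1) c)) = 0 := by
      by_contra h; have := cf_toTorus_pbw h2 h; omega
    rw [h1, h3, add_zero, smul_zero]

/-- In the right ideal of `Y`, the linear combinations of `X` and `φ` are multiples of `φ - X`. -/
theorem eq_of_Y_mul_eq {z : AgeingAlgebra 𝕜 (q : 𝕜)} {r s : 𝕜}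
    (h : toTorus h2 (Y (q : 𝕜) * z) = mono q 0 0 0 1 r - mono q 0 0 1 0 s) : r = s := by
  have h4 := cf_Y_mul h2 z
  have h1 : cf q 0 0 0 1 (mono q 0 0 1 0 s) = 0 := by
    by_contra h; have := eq_of_cf_mono_ne_zero h; omega
  have h3 : cf q 0 0 1 0 (mono q 0 0 0 1 r) = 0 := by
    by_contra h; have := eq_of_cf_mono_ne_zero h; omega
  rw [h, map_sub, map_sub, cf_mono_same, cf_mono_same, h1, h3, sub_zero, zero_sub,
    add_neg_eq_zero] at h4
  exact h4

end

end AgeingAlgebra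

/-! ### The automorphisms `sigma` and their composition -/

namespace AgeingAlgebra

noncomputable section

variable {𝕜 : Type*} [Field 𝕜] (q : 𝕜ˣ)

theorem Kpow_mul_mul_Kpow_mul {U V : AgeingAlgebra 𝕜 (q : 𝕜)} {b : ℤ} {r : 𝕜} (a : ℤ)
    (h : U * Kpow (q : 𝕜) b = r • (Kpow (q : 𝕜) b * U)) :
    Kpow (q : 𝕜) a * U * (Kpow (q : 𝕜) b * V) = r • (Kpow (q : 𝕜) (a + b) * (U * V)) := by
  rw [mul_assoc, ← mul_assoc U, h, smul_mul_assoc, mul_smul_comm, Kpow_add]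
  simp only [mul_assoc]

theorem Kpow_mul_mul_Ku {U : AgeingAlgebra 𝕜 (q : 𝕜)} {r : 𝕜} (a : ℤ)
    (h : U * (Ku (q : 𝕜) : AgeingAlgebra 𝕜 (q : 𝕜)) =
      r • ((Ku (q : 𝕜) : AgeingAlgebra 𝕜 (q : 𝕜)) * U)) :
    Kpow (q : 𝕜) a * U * (Ku (q : 𝕜) : AgeingAlgebra 𝕜 (q : 𝕜)) =
      r • ((Ku (q : 𝕜) : AgeingAlgebra 𝕜 (q : 𝕜)) * (Kpow (q : 𝕜) a * U)) := by
  rw [mul_assoc, h, mul_smul_comm, ← mul_assoc, ← mul_assoc, ← Kpow_one, ← Kpow_add, ← Kpow_add,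
    add_comm]

/-- The scalar `g` times `K`, as a unit. -/
def scaledK (g : 𝕜ˣ) : (AgeingAlgebra 𝕜 (q : 𝕜))ˣ :=
  Units.map (algebraMap 𝕜 (AgeingAlgebra 𝕜 (q : 𝕜)) : 𝕜 →* AgeingAlgebra 𝕜 (q : 𝕜)) g * Ku (q : 𝕜)

theorem scaledK_val (g : 𝕜ˣ) : (scaledK q g : AgeingAlgebra 𝕜 (q : 𝕜)) =
    (g : 𝕜) • (Ku (q : 𝕜) : AgeingAlgebra 𝕜 (q : 𝕜)) := by
  rw [Algebra.smul_def]
  rfl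

theorem scaledK_zpow (g : 𝕜ˣ) (n : ℤ) : ((scaledK q g ^ n : (AgeingAlgebra 𝕜 (q : 𝕜))ˣ) :
    AgeingAlgebra 𝕜 (q : 𝕜)) = (g : 𝕜) ^ n • Kpow (q : 𝕜) n := by
  have hc : Commute (Units.map (algebraMap 𝕜 (AgeingAlgebra 𝕜 (q : 𝕜)) : 𝕜 →* _) g) (Ku (q : 𝕜)) :=
    Units.ext (Algebra.commutes (g : 𝕜) (Ku (q : 𝕜) : AgeingAlgebra 𝕜 (q : 𝕜)))
  rw [scaledK, hc.mul_zpow, ← map_zpow, Algebra.smul_def, ← Units.val_zpow_eq_zpow_val]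
  rfl

/-- The endomorphism `X ↦ l K ^ i X`, `Y ↦ m K ^ (-i) Y`, `K ↦ g K`. -/
def sigmaHom (l m g : 𝕜ˣ) (i : ℤ) :
    AgeingAlgebra 𝕜 (q : 𝕜) →ₐ[𝕜] AgeingAlgebra 𝕜 (q : 𝕜) :=
  lift (((l : 𝕜) * (m : 𝕜)⁻¹ * (q : 𝕜) ^ (-2 * i)) • (Kpow (q : 𝕜) (2 * i) * E (q : 𝕜)))
    ((l : 𝕜) • (Kpow (q : 𝕜) i * X (q : 𝕜))) ((m : 𝕜) • (Kpow (q : 𝕜) (-i) * Y (q : 𝕜)))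
    (scaledK q g)
    (by
      rw [scaledK_val]
      simp only [smul_mul_assoc, mul_smul_comm, Kpow_mul_mul_Ku q _ (E_mul_Ku (q : 𝕜))]
      module)
    (by
      rw [scaledK_val]
      simp only [smul_mul_assoc, mul_smul_comm, Kpow_mul_mul_Ku q _ (X_mul_Ku (q : 𝕜))]
      module)
    (by
      rw [scaledK_val]
      simp only [smul_mul_assoc, mul_smul_comm, Kpow_mul_mul_Ku q _ (Y_mul_Ku (q : 𝕜))]
      module)
    (by
      simp only [smul_mul_assoc, mul_smul_comm, Kpow_mul_mul_Kpow_mul q _ (E_mul_Kpow q _),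
        Kpow_mul_mul_Kpow_mul q _ (X_mul_Kpow q _), E_mul_X, neg_mul, add_comm i]
      module)
    (by
      have hm : (m : 𝕜)⁻¹ * m = 1 := inv_mul_cancel₀ m.ne_zero
      -- The factor `q ^ (-2 * i)` in the image of `E` cancels the `q ^ (2 * i)` from moving `E`
      -- past `K ^ (-i)`, and equally that from moving `Y` past `K ^ (2 * i)`.
      have hq : (q : 𝕜) ^ (-(2 * i)) * (q : 𝕜) ^ (2 * i) = 1 := by
        rw [← zpow_add₀ q.ne_zero, neg_add_cancel, zpow_zero]
      simp only [smul_mul_assoc, mul_smul_comm, Kpow_mul_mul_Kpow_mul q _ (E_mul_Kpow q _),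
        Kpow_mul_mul_Kpow_mul q _ (Y_mul_Kpow q _), E_mul_Y, mul_neg, neg_mul, mul_add, neg_neg,
        Units.val_zpow_eq_zpow_val]
      have h1 : 2 * i + -i = i := by ring
      have h2 : -i + 2 * i = i := by ring
      rw [h1, h2]
      simp only [smul_smul, smul_add]
      congr 2
      · linear_combination (l : 𝕜) * (q : 𝕜) ^ (-(2 * i)) * (q : 𝕜) ^ (2 * i) * hm + l * hq
      · ring)
    (by
      simp only [smul_mul_assoc, mul_smul_comm, Kpow_mul_mul_Kpow_mul q _ (X_mul_Kpow q _),
        Kpow_mul_mul_Kpow_mul q _ (Y_mul_Kpow q _), X_mul_Y, neg_neg, add_comm (-i)]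
      module)

theorem sigmaHom_comp (l m g l' m' g' : 𝕜ˣ) (i j : ℤ) :
    (sigmaHom q l m g i).comp (sigmaHom q l' m' g' j) =
      sigmaHom q (l * l' * g ^ j) (m * m' * g ^ (-j)) (g * g') (i + j) := by
  have hK : ∀ n, sigmaHom q l m g i (Kpow (q : 𝕜) n) = (g : 𝕜) ^ n • Kpow (q : 𝕜) n := by
    intro n
    have h : Units.map (sigmaHom q l m g i : AgeingAlgebra 𝕜 (q : 𝕜) →* _) (Ku (q : 𝕜)) =
        scaledK q g := Units.ext lift_Ku
    rw [← scaledK_zpow, ← h, ← map_zpow]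
    rfl
  refine algHom_ext ?_ ?_ ?_ ?_
  · simp only [AlgHom.comp_apply]
    rw [sigmaHom.eq_1 q l' m' g' j, sigmaHom.eq_1 q (l * l' * g ^ j), lift_E, lift_E, map_smul,
      map_mul, hK, sigmaHom.eq_1 q l m g i, lift_E]
    simp only [smul_mul_assoc, mul_smul_comm, ← mul_assoc, ← Kpow_add]
    have h1 : 2 * j + 2 * i = 2 * (i + j) := by ring
    have h2 : -2 * (i + j) = -2 * i + -2 * j := by ring
    have h3 : (g : 𝕜) ^ (2 * j) = (g : 𝕜) ^ j * (g : 𝕜) ^ j := by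
      rw [← zpow_add₀ g.ne_zero, two_mul]
    rw [h1, h2, zpow_add₀ q.ne_zero, h3]
    simp only [smul_smul, Units.val_mul, Units.val_zpow_eq_zpow_val, Units.val_inv_eq_inv_val,
      zpow_neg]
    congr 1
    field_simp
  · simp only [AlgHom.comp_apply]
    rw [sigmaHom.eq_1 q l' m' g' j, sigmaHom.eq_1 q (l * l' * g ^ j), lift_X, lift_X, map_smul,
      map_mul, hK, sigmaHom.eq_1 q l m g i, lift_X]
    simp only [smul_mul_assoc, mul_smul_comm, ← mul_assoc, ← Kpow_add, add_comm j]
    simp only [smul_smul, Units.val_mul, Units.val_zpow_eq_zpow_val]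
    congr 1
    ring
  · simp only [AlgHom.comp_apply]
    rw [sigmaHom.eq_1 q l' m' g' j, sigmaHom.eq_1 q (l * l' * g ^ j), lift_Y, lift_Y, map_smul,
      map_mul, hK, sigmaHom.eq_1 q l m g i, lift_Y]
    simp only [smul_mul_assoc, mul_smul_comm, ← mul_assoc, ← Kpow_add, neg_add, add_comm (-j)]
    simp only [smul_smul, Units.val_mul, Units.val_zpow_eq_zpow_val]
    congr 1
    ring
  · simp only [AlgHom.comp_apply]
    rw [sigmaHom.eq_1 q l' m' g' j, sigmaHom.eq_1 q (l * l' * g ^ j), lift_Ku, lift_Ku, scaledK_val,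
      map_smul, sigmaHom.eq_1 q l m g i, lift_Ku, scaledK_val, scaledK_val, smul_smul, Units.val_mul,
      mul_comm]

theorem sigmaHom_one : sigmaHom q 1 1 1 0 = AlgHom.id 𝕜 (AgeingAlgebra 𝕜 (q : 𝕜)) := by
  refine algHom_ext ?_ ?_ ?_ ?_
  · rw [sigmaHom, lift_E]; simp [Kpow_zero]
  · rw [sigmaHom, lift_X]; simp [Kpow_zero]
  · rw [sigmaHom, lift_Y]; simp [Kpow_zero]
  · rw [sigmaHom, lift_Ku]; simp [scaledK_val]

/-- The automorphism `X ↦ l K ^ i X`, `Y ↦ m K ^ (-i) Y`, `K ↦ g K`. -/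
def sigma (l m g : 𝕜ˣ) (i : ℤ) : AgeingAlgebra 𝕜 (q : 𝕜) ≃ₐ[𝕜] AgeingAlgebra 𝕜 (q : 𝕜) :=
  AlgEquiv.ofAlgHom (sigmaHom q l m g i)
    (sigmaHom q (l⁻¹ * g ^ i) (m⁻¹ * g ^ (-i)) g⁻¹ (-i))
    (by
      rw [sigmaHom_comp, ← sigmaHom_one]
      congr 1 <;> simp)
    (by
      rw [sigmaHom_comp, ← sigmaHom_one]
      congr 1 <;> simp)

theorem sigma_X (l m g : 𝕜ˣ) (i : ℤ) :
    sigma q l m g i (X (q : 𝕜)) = (l : 𝕜) • (Kpow (q : 𝕜) i * X (q : 𝕜)) := lift_X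

theorem sigma_Y (l m g : 𝕜ˣ) (i : ℤ) :
    sigma q l m g i (Y (q : 𝕜)) = (m : 𝕜) • (Kpow (q : 𝕜) (-i) * Y (q : 𝕜)) := lift_Y

theorem sigma_E (l m g : 𝕜ˣ) (i : ℤ) : sigma q l m g i (E (q : 𝕜)) =
    ((l : 𝕜) * (m : 𝕜)⁻¹ * (q : 𝕜) ^ (-2 * i)) • (Kpow (q : 𝕜) (2 * i) * E (q : 𝕜)) := lift_E

theorem sigma_Ku (l m g : 𝕜ˣ) (i : ℤ) :
    sigma q l m g i (Ku (q : 𝕜) : AgeingAlgebra 𝕜 (q : 𝕜)) =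
      (g : 𝕜) • (Ku (q : 𝕜) : AgeingAlgebra 𝕜 (q : 𝕜)) :=
  (lift_Ku).trans (scaledK_val q g)

theorem sigma_mul (l m g l' m' g' : 𝕜ˣ) (i j : ℤ) :
    sigma q l m g i * sigma q l' m' g' j =
      sigma q (l * l' * g ^ j) (m * m' * g ^ (-j)) (g * g') (i + j) :=
  AlgEquiv.ext fun a => DFunLike.congr_fun (sigmaHom_comp q l m g l' m' g' i j) a

theorem sigma_one : sigma q 1 1 1 0 = 1 :=
  AlgEquiv.ext fun a => DFunLike.congr_fun (sigmaHom_one q) a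

theorem sigma_inv (l m g : 𝕜ˣ) (i : ℤ) :
    (sigma q l m g i)⁻¹ = sigma q (l⁻¹ * g ^ i) (m⁻¹ * g ^ (-i)) g⁻¹ (-i) := by
  refine inv_eq_of_mul_eq_one_right ?_
  rw [sigma_mul, ← sigma_one]
  congr 1 <;> simp

/-- The product `Y E` is scaled exactly as `X` is, hence so is `φ`. It also identifies the image of
`E` once the image of `Y` is cancelled. -/
theorem sigma_Y_mul_E (l m g : 𝕜ˣ) (i : ℤ) : sigma q l m g i (Y (q : 𝕜) * E (q : 𝕜)) =
    (l : 𝕜) • (Kpow (q : 𝕜) i * (Y (q : 𝕜) * E (q : 𝕜))) := by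
  have h2 : -i + 2 * i = i := by ring
  rw [map_mul, sigma_Y, sigma_E, smul_mul_assoc, mul_smul_comm,
    Kpow_mul_mul_Kpow_mul q _ (Y_mul_Kpow q _), h2, smul_smul, smul_smul,
    Units.val_zpow_eq_zpow_val, neg_mul, zpow_neg]
  have := zpow_ne_zero (2 * i) q.ne_zero
  congr 1
  field_simp

theorem sigma_phi (l m g : 𝕜ˣ) (i : ℤ) : sigma q l m g i (phi (q : 𝕜)) =
    (l : 𝕜) • (Kpow (q : 𝕜) i * phi (q : 𝕜)) := by
  rw [phi_eq, map_add, map_smul, sigma_Y_mul_E, sigma_X, mul_add, mul_smul_comm, smul_add,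
    smul_comm (l : 𝕜)]

end

end AgeingAlgebra

/-! ### Normalizing elements and units -/

namespace AgeingAlgebra

noncomputable section

/-- The lexicographic order on the exponents of the quantum torus, as an embedding. -/
def lexHom : ℤ × ℤ × ℤ × ℤ →+ ℤ ×ₗ ℤ ×ₗ ℤ ×ₗ ℤ :=
  AddMonoidHom.mk' (fun u => toLex (u.1, toLex (u.2.1, toLex (u.2.2.1, u.2.2.2))))
    fun _ _ => rfl

theorem lexHom_injective : Function.Injective lexHom := fun u v h => by
  have h' : (u.1, u.2.1, u.2.2.1, u.2.2.2) = (v.1, v.2.1, v.2.2.1, v.2.2.2) := h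
  exact h'

/-- The exponent of `Y` is the first coordinate, so a leading monomial has maximal `Y`-degree. -/
theorem fst_le_of_lexHom_le {u v : ℤ × ℤ × ℤ × ℤ} (h : lexHom u ≤ lexHom v) : u.1 ≤ v.1 := by
  rcases Prod.Lex.toLex_le_toLex.1 h with h | h
  · exact h.le
  · exact h.1.le

variable {𝕜 : Type*} [Field 𝕜] {q : 𝕜ˣ} (h2 : (q : 𝕜)⁻¹ - q ≠ 0)

theorem torus_mul_ne_zero {f g : Torus q} (hf : f ≠ 0) (hg : g ≠ 0) : f * g ≠ 0 :=
  TwistedAlgebra.mul_ne_zero_of_injective lexHom_injective hf hg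

theorem torus_mul_left_cancel {f g g' : Torus q} (hf : f ≠ 0) (h : f * g = f * g') : g = g' := by
  by_contra hne
  exact torus_mul_ne_zero hf (sub_ne_zero.2 hne) (by rw [mul_sub, h, sub_self])

theorem torus_mul_right_cancel {f g g' : Torus q} (hf : f ≠ 0) (h : g * f = g' * f) : g = g' := by
  by_contra hne
  exact torus_mul_ne_zero (sub_ne_zero.2 hne) hf (by rw [sub_mul, h, sub_self])

theorem mono_ne_zero {b k i j : ℤ} {a : 𝕜} (ha : a ≠ 0) : mono q b k i j a ≠ 0 :=
  TwistedAlgebra.single_ne_zero ha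

instance : Nontrivial (Torus q) := ⟨⟨1, 0, mono_ne_zero one_ne_zero⟩⟩

/-- The commutation rule for monomials. -/
theorem mono_mul_comm (b k i j b' k' i' j' : ℤ) (a a' : 𝕜) :
    mono q b k i j a * mono q b' k' i' j' a' =
      (q : 𝕜) ^ ((b * k' - b * i' + b * j' - j * k' - i * k') -
        (b' * k - b' * i + b' * j - j' * k - i' * k)) •
        (mono q b' k' i' j' a' * mono q b k i j a) := by
  rw [mono_mul_mono, mono_mul_mono, smul_mono, add_comm b', add_comm k', add_comm i', add_comm j']
  generalize b * k' - b * i' + b * j' - j * k' - i * k' = m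
  generalize b' * k - b' * i + b' * j - j' * k - i' * k = n
  rw [← mul_assoc (_ ^ (m - n)), ← zpow_add₀ q.ne_zero, sub_add_cancel, mul_comm a']

theorem eq_zpow_of_mul_mono_eq {x : Torus q} {b' k' i' j' : ℤ} {r c : 𝕜} (hr : r ≠ 0)
    (e : x * mono q b' k' i' j' r = c • (mono q b' k' i' j' r * x)) {b k i j : ℤ}
    (h : cf q b k i j x ≠ 0) : c = (q : 𝕜) ^ ((b * k' - b * i' + b * j' - j * k' - i * k') -
        (b' * k - b' * i + b' * j - j' * k - i' * k)) := by
  have := TwistedAlgebra.eq_zpow_of_mul_single_eq hr e h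
  rwa [torusForm_apply, torusForm_apply, Units.val_zpow_eq_zpow_val] at this

theorem mul_mono_eq_of_mul_mono_eq {x a : Torus q} {b k i j : ℤ} (hx : x ≠ 0)
    (e : x * mono q b k i j 1 = a * x) :
    ∃ c : 𝕜, a = mono q b k i j c ∧ x * mono q b k i j 1 = c • (mono q b k i j 1 * x) := by
  have h := TwistedAlgebra.eq_single_of_mul_single_eq lexHom_injective hx e
  refine ⟨_, h, ?_⟩
  rw [← smul_mul_assoc, smul_mono, mul_one, e]
  exact congrArg (· * x) h

/-- A nonzero element `x` with `x A ⊆ A x`. -/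
def IsNormalizing (x : AgeingAlgebra 𝕜 (q : 𝕜)) : Prop := x ≠ 0 ∧ ∀ a, ∃ a', x * a = a' * x

theorem IsNormalizing.map {x : AgeingAlgebra 𝕜 (q : 𝕜)} (hx : IsNormalizing x)
    (τ : AgeingAlgebra 𝕜 (q : 𝕜) ≃ₐ[𝕜] AgeingAlgebra 𝕜 (q : 𝕜)) : IsNormalizing (τ x) := by
  refine ⟨(map_ne_zero_iff τ τ.injective).2 hx.1, fun a => ?_⟩
  obtain ⟨a', h⟩ := hx.2 (τ.symm a)
  exact ⟨τ a', by rw [← map_mul, ← h, map_mul, τ.apply_symm_apply]⟩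

variable (hinj : Function.Injective fun n : ℤ => (q : 𝕜) ^ n)

include hinj in
-- The image of `x` commutes up to scalars with `K, X, Y, φ`; the commutation form is nondegenerate
-- and `q` is not a root of unity, so only one monomial occurs. Normalizing `E`, which is not a
-- monomial, then excludes powers of `Y`.
theorem IsNormalizing.toTorus_eq {x : AgeingAlgebra 𝕜 (q : 𝕜)} (hx : IsNormalizing x) :
    ∃ k i j : ℤ, ∃ c : 𝕜, c ≠ 0 ∧ 0 ≤ i ∧ 0 ≤ j ∧ toTorus h2 x = mono q 0 k i j c := by
  set ξ := toTorus h2 x with hξ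
  have hξ0 : ξ ≠ 0 := (map_ne_zero_iff _ (toTorus_injective h2)).2 hx.1
  have key : ∀ b k i j, ∀ a, toTorus h2 a = mono q b k i j 1 →
      ∃ c : 𝕜, ξ * mono q b k i j 1 = c • (mono q b k i j 1 * ξ) := by
    intro b k i j a ha
    obtain ⟨a', h⟩ := hx.2 a
    have h' := congrArg (toTorus h2) h
    rw [map_mul, map_mul, ha] at h'
    obtain ⟨c, -, hc⟩ := mul_mono_eq_of_mul_mono_eq hξ0 h'
    exact ⟨c, hc⟩
  obtain ⟨cK, hK⟩ := key _ _ _ _ _ (toTorus_Ku h2)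
  obtain ⟨cX, hX⟩ := key _ _ _ _ _ (toTorus_X h2)
  obtain ⟨cY, hY⟩ := key _ _ _ _ _ (toTorus_Y h2)
  obtain ⟨cφ, hφ⟩ := key _ _ _ _ _ (toTorus_phi h2)
  obtain ⟨⟨b, k, i, j⟩, hu⟩ := TwistedAlgebra.exists_coeff_ne_zero hξ0
  -- The commutation exponents with `K, X, Y, φ` are `b - i - j`, `k - b`, `-(k - i + j)` and `b +
  -- k`; they determine `(b, k, i, j)`.
  have hmono : ξ = mono q b k i j (cf q b k i j ξ) := by
    refine TwistedAlgebra.eq_single_of_forall ?_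
    rintro ⟨b', k', i', j'⟩ hu'
    have eK := hinj ((eq_zpow_of_mul_mono_eq one_ne_zero hK hu).symm.trans
      (eq_zpow_of_mul_mono_eq one_ne_zero hK hu'))
    have eX := hinj ((eq_zpow_of_mul_mono_eq one_ne_zero hX hu).symm.trans
      (eq_zpow_of_mul_mono_eq one_ne_zero hX hu'))
    have eY := hinj ((eq_zpow_of_mul_mono_eq one_ne_zero hY hu).symm.trans
      (eq_zpow_of_mul_mono_eq one_ne_zero hY hu'))
    have eφ := hinj ((eq_zpow_of_mul_mono_eq one_ne_zero hφ hu).symm.trans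
      (eq_zpow_of_mul_mono_eq one_ne_zero hφ hu'))
    simp only [Prod.mk.injEq]
    omega
  have hij := nonneg_of_cf_ne_zero h2 hu
  suffices hb : b = 0 by
    subst hb
    exact ⟨k, i, j, _, hu, hij.1, hij.2.1, hmono⟩
  set c := cf q b k i j ξ
  obtain ⟨e', he'⟩ := hx.2 (E (q : 𝕜))
  have he'' := congrArg (toTorus h2) he'
  rw [map_mul, map_mul, toTorus_E, ← hξ] at he''
  have hYξ := mono_mul_comm (q := q) b k i j 1 0 0 0 c 1
  rw [← hmono] at hYξ
  set r := (q : 𝕜) ^ ((b * 0 - b * 0 + b * 0 - j * 0 - i * 0) - (1 * k - 1 * i + 1 * j - 0 * k - 0 * k))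
  -- Carrying `Y E`, a multiple of `φ - X`, to the left of `ξ` gives an element of the right ideal
  -- of `Y`. The summands `φ` and `X` acquire the factors `q ^ (b + k)` and `q ^ (k - b)`, which
  -- must agree by `eq_of_Y_mul_eq`; this forces `b = 0`.
  obtain ⟨z, h3⟩ : ∃ z, toTorus h2 (Y (q : 𝕜) * z) * ξ = ξ * (mono q 1 0 0 0 1 * torusE q) := by
    refine ⟨r • e', ?_⟩
    rw [← mul_assoc, hYξ, map_mul, map_smul, toTorus_Y, mul_smul_comm, smul_mul_assoc,
      smul_mul_assoc, mul_assoc, mul_assoc, he'']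
  have hXξ := mono_mul_comm (q := q) b k i j 0 0 1 0 c 1
  have hφξ := mono_mul_comm (q := q) b k i j 0 0 0 1 c 1
  rw [← hmono] at hXξ hφξ
  rw [mono_Y_mul_torusE, mul_smul_comm, mul_sub, hXξ, hφξ, ← smul_mul_assoc, ← smul_mul_assoc,
    ← sub_mul, ← smul_mul_assoc, smul_sub, smul_mono, smul_mono, smul_mono, smul_mono] at h3
  have h4 := mul_left_cancel₀ (inv_ne_zero h2) (eq_of_Y_mul_eq h2 (torus_mul_right_cancel hξ0 h3))
  simp only [mul_one] at h4
  have h5 := hinj h4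
  omega

theorem isNormalizing_of_gen {x : AgeingAlgebra 𝕜 (q : 𝕜)} (hx : x ≠ 0)
    (h : ∀ g, ∃ a', x * gen (q : 𝕜) g = a' * x) : IsNormalizing x := by
  refine ⟨hx, fun a => ?_⟩
  obtain ⟨f, rfl⟩ := RingQuot.mkAlgHom_surjective 𝕜 (AgeingRel (q : 𝕜)) a
  induction f using FreeAlgebra.induction with
  | grade0 r => exact ⟨algebraMap 𝕜 _ r, by rw [AlgHom.commutes, Algebra.commutes]⟩
  | grade1 g => exact h g
  | mul f g hf hg =>
    obtain ⟨a, ha⟩ := hf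
    obtain ⟨b, hb⟩ := hg
    exact ⟨a * b, by rw [map_mul, ← mul_assoc, ha, mul_assoc, hb, mul_assoc]⟩
  | add f g hf hg =>
    obtain ⟨a, ha⟩ := hf
    obtain ⟨b, hb⟩ := hg
    exact ⟨a + b, by rw [map_add, mul_add, ha, hb, add_mul]⟩

include h2 in
theorem isNormalizing_of_toTorus_eq {x : AgeingAlgebra 𝕜 (q : 𝕜)} {k i j : ℤ} {c : 𝕜} (hc : c ≠ 0)
    (hx : toTorus h2 x = mono q 0 k i j c) : IsNormalizing x := by
  have key : ∀ b k' i' j' g, toTorus h2 (gen (q : 𝕜) g) = mono q b k' i' j' 1 →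
      ∃ a', x * gen (q : 𝕜) g = a' * x := fun b k' i' j' g hg => by
    obtain ⟨r, hr⟩ : ∃ r : 𝕜, mono q 0 k i j c * mono q b k' i' j' 1 =
        r • (mono q b k' i' j' 1 * mono q 0 k i j c) := ⟨_, mono_mul_comm ..⟩
    refine ⟨r • gen (q : 𝕜) g, toTorus_injective h2 ?_⟩
    rw [map_mul, map_mul, map_smul, hg, hx, hr, smul_mul_assoc]
  refine isNormalizing_of_gen (fun h => ?_) fun g => ?_
  · rw [h, map_zero] at hx
    exact mono_ne_zero hc hx.symm
  cases g with
  | K => exact key _ _ _ _ _ (toTorus_Ku h2)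
  | Kinv =>
    have h := toTorus_Kpow h2 (-1)
    rw [Kpow, zpow_neg_one] at h
    exact key _ _ _ _ _ h
  | X => exact key _ _ _ _ _ (toTorus_X h2)
  | Y => exact key _ _ _ _ _ (toTorus_Y h2)
  | E =>
    -- Without a factor `Y`, the monomial has the same commutation exponent `2k - i + j` with `φ
    -- Y⁻¹` and `X Y⁻¹`, so it commutes with `E` up to that power of `q`.
    refine ⟨(q : 𝕜) ^ (k + (k - i + j)) • E (q : 𝕜), toTorus_injective h2 ?_⟩
    change toTorus h2 (x * E (q : 𝕜)) = _
    rw [map_mul, map_mul, map_smul, toTorus_E, hx, torusE, mul_sub, mono_mul_comm 0,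
      mono_mul_comm 0 k i j (-1) 0 1 0, smul_mul_assoc, sub_mul, smul_sub]
    congr 3 <;> ring

include h2 in
theorem X_isNormalizing : IsNormalizing (X (q : 𝕜)) :=
  isNormalizing_of_toTorus_eq h2 one_ne_zero (toTorus_X h2)

include h2 in
theorem phi_isNormalizing : IsNormalizing (phi (q : 𝕜)) :=
  isNormalizing_of_toTorus_eq h2 one_ne_zero (toTorus_phi h2)

/-- Units of the torus are monomials, and the constraints of `nonneg_of_cf_ne_zero` for `u` and
`u⁻¹` together force `b = i = j = 0`. -/
theorem toTorus_unit (u : (AgeingAlgebra 𝕜 (q : 𝕜))ˣ) :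
    ∃ n : ℤ, ∃ c : 𝕜, c ≠ 0 ∧ toTorus h2 u = mono q 0 n 0 0 c := by
  have h := congrArg (toTorus h2) u.mul_inv
  rw [map_mul, map_one] at h
  obtain ⟨⟨b, k, i, j⟩, c, d, hc, hd, h3, h4⟩ :=
    TwistedAlgebra.eq_single_of_mul_eq_one lexHom_injective h
  have h4' : toTorus h2 (u⁻¹ : (AgeingAlgebra 𝕜 (q : 𝕜))ˣ) = mono q (-b) (-k) (-i) (-j) d := h4
  have h5 := nonneg_of_cf_ne_zero h2 (a := u) (b := b) (k := k) (i := i) (j := j)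
    (by rw [h3]; exact (cf_mono_same b k i j c).trans_ne hc)
  have h6 := nonneg_of_cf_ne_zero h2 (a := (u⁻¹ : (AgeingAlgebra 𝕜 (q : 𝕜))ˣ)) (b := -b) (k := -k)
    (i := -i) (j := -j) (by rw [h4']; exact (cf_mono_same _ _ _ _ d).trans_ne hd)
  obtain ⟨rfl, rfl, rfl⟩ : b = 0 ∧ i = 0 ∧ j = 0 := by omega
  exact ⟨k, c, hc, h3⟩

include h2 in
theorem mul_left_cancel_of_ne_zero {a b b' : AgeingAlgebra 𝕜 (q : 𝕜)} (ha : a ≠ 0)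
    (h : a * b = a * b') : b = b' := by
  have h' := congrArg (toTorus h2) h
  rw [map_mul, map_mul] at h'
  exact toTorus_injective h2
    (torus_mul_left_cancel ((map_ne_zero_iff _ (toTorus_injective h2)).2 ha) h')

end

-- Classification of the automorphisms

end AgeingAlgebra

namespace AgeingAlgebra

noncomputable section

variable {𝕜 : Type*} [Field 𝕜] {q : 𝕜ˣ} (h2 : (q : 𝕜)⁻¹ - q ≠ 0)
  (hinj : Function.Injective fun n : ℤ => (q : 𝕜) ^ n)
  (τ : AgeingAlgebra 𝕜 (q : 𝕜) ≃ₐ[𝕜] AgeingAlgebra 𝕜 (q : 𝕜))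

theorem phi_mul_Ku : phi (q : 𝕜) * (Ku (q : 𝕜) : AgeingAlgebra 𝕜 (q : 𝕜)) =
    (q : 𝕜)⁻¹ • ((Ku (q : 𝕜) : AgeingAlgebra 𝕜 (q : 𝕜)) * phi (q : 𝕜)) := by
  have h : Y (q : 𝕜) * E (q : 𝕜) * (Ku (q : 𝕜) : AgeingAlgebra 𝕜 (q : 𝕜)) =
      (q : 𝕜)⁻¹ • ((Ku (q : 𝕜) : AgeingAlgebra 𝕜 (q : 𝕜)) * (Y (q : 𝕜) * E (q : 𝕜))) := by
    have hq := q.ne_zero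
    rw [mul_assoc, E_mul_Ku, mul_smul_comm, ← mul_assoc, Y_mul_Ku, smul_mul_assoc, smul_smul,
      mul_assoc]
    congr 1
    field_simp
  rw [phi_eq, add_mul, mul_add, smul_mul_assoc, mul_smul_comm, h, X_mul_Ku]
  module

include hinj in
-- Commutation of `a` with `K` by the factor `q ^ w` is carried to commutation of `τ a` with `g K ^
-- n`, and `K ^ k * X ^ i * φ ^ j * Y ^ b` commutes with `K ^ n` by `q ^ (n * (b - i - j))`.
theorem weight_of_cf_ne_zero {n : ℤ} {g : 𝕜} (hg : g ≠ 0)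
    (hK : toTorus h2 (τ (Ku (q : 𝕜) : AgeingAlgebra 𝕜 (q : 𝕜))) = mono q 0 n 0 0 g)
    {a : AgeingAlgebra 𝕜 (q : 𝕜)} {w : ℤ}
    (ha : a * (Ku (q : 𝕜) : AgeingAlgebra 𝕜 (q : 𝕜)) =
      (q : 𝕜) ^ w • ((Ku (q : 𝕜) : AgeingAlgebra 𝕜 (q : 𝕜)) * a)) {b k i j : ℤ}
    (h : cf q b k i j (toTorus h2 (τ a)) ≠ 0) : n * (b - i - j) = w := by
  have h3 := congrArg (fun z => toTorus h2 (τ z)) ha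
  simp only [map_mul, map_smul, hK] at h3
  have h4 := hinj (eq_zpow_of_mul_mono_eq hg h3 h)
  linarith

include hinj in
/-- An automorphism multiplies `K` by a scalar, and preserves the pair `X`, `φ` up to units. -/
theorem exists_toTorus_aut :
    ∃ (g l l' : 𝕜) (p i j p' i' j' : ℤ), g ≠ 0 ∧ l ≠ 0 ∧ l' ≠ 0 ∧ 0 ≤ i ∧ 0 ≤ j ∧ i + j = 1 ∧
      0 ≤ i' ∧ 0 ≤ j' ∧ i' + j' = 1 ∧
      toTorus h2 (τ (Ku (q : 𝕜) : AgeingAlgebra 𝕜 (q : 𝕜))) = mono q 0 1 0 0 g ∧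
      toTorus h2 (τ (X (q : 𝕜))) = mono q 0 p i j l ∧
      toTorus h2 (τ (phi (q : 𝕜))) = mono q 0 p' i' j' l' := by
  obtain ⟨n, g, hg, hK⟩ := toTorus_unit h2
    (Units.map (τ : AgeingAlgebra 𝕜 (q : 𝕜) →* AgeingAlgebra 𝕜 (q : 𝕜)) (Ku (q : 𝕜)))
  replace hK : toTorus h2 (τ (Ku (q : 𝕜) : AgeingAlgebra 𝕜 (q : 𝕜))) = mono q 0 n 0 0 g := hK
  obtain ⟨p, i, j, l, hl, hi, hj, hX⟩ := ((X_isNormalizing h2).map τ).toTorus_eq h2 hinj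
  obtain ⟨p', i', j', l', hl', hi', hj', hφ⟩ := ((phi_isNormalizing h2).map τ).toTorus_eq h2 hinj
  have h3 := weight_of_cf_ne_zero (w := -1) h2 hinj τ hg hK
    (by rw [zpow_neg_one]; exact X_mul_Ku (q : 𝕜))
    (by rw [hX]; exact (cf_mono_same 0 p i j l).trans_ne hl)
  have h4 := weight_of_cf_ne_zero (w := -1) h2 hinj τ hg hK
    (by rw [zpow_neg_one]; exact phi_mul_Ku)
    (by rw [hφ]; exact (cf_mono_same 0 p' i' j' l').trans_ne hl')
  have h5 : n * (i + j) = 1 := by linarith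
  have h6 : n = 1 := by
    -- The case `n = -1` is excluded by `i, j ≥ 0`.
    rcases Int.mul_eq_one_iff_eq_one_or_neg_one.1 h5 with h | h <;> omega
  subst h6
  exact ⟨g, l, l', p, i, j, p', i', j', hg, hl, hl', hi, hj, by omega, hi', hj', by omega,
    hK, hX, hφ⟩

include h2 in
theorem Y_mul_E : Y (q : 𝕜) * E (q : 𝕜) = ((q : 𝕜)⁻¹ - q)⁻¹ • phi (q : 𝕜) -
    ((q : 𝕜)⁻¹ - q)⁻¹ • X (q : 𝕜) := by
  apply toTorus_injective h2
  rw [map_mul, map_sub, map_smul, map_smul, toTorus_Y, toTorus_E, toTorus_X, toTorus_phi,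
    mono_Y_mul_torusE, smul_sub]

include h2 in
theorem Y_ne_zero : Y (q : 𝕜) ≠ 0 := fun h => by
  have h' := toTorus_Y h2
  rw [h, map_zero] at h'
  exact mono_ne_zero one_ne_zero h'.symm

include h2 in
theorem E_ne_zero : E (q : 𝕜) ≠ 0 := fun h => by
  have h' := cf_toTorus_pbw_ne_zero h2 0 0 0 1
  simp [pbw, h] at h'

include h2 hinj in
theorem exists_eq_sigma : ∃ (l m g : 𝕜ˣ) (i : ℤ), τ = sigma q l m g i := by
  obtain ⟨g, l, l', p, i, j, p', i', j', hg, hl, hl', hi, hj, hij, hi', hj', hij', hK, hX, hφ⟩ :=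
    exists_toTorus_aut h2 hinj τ
  have hYE : toTorus h2 (τ (Y (q : 𝕜))) * toTorus h2 (τ (E (q : 𝕜))) =
      ((q : 𝕜)⁻¹ - q)⁻¹ • mono q 0 p' i' j' l' - ((q : 𝕜)⁻¹ - q)⁻¹ • mono q 0 p i j l := by
    rw [← map_mul, ← map_mul, Y_mul_E h2, map_sub, map_smul, map_smul, map_sub, map_smul, map_smul,
      hX, hφ]
  have hY0 : toTorus h2 (τ (Y (q : 𝕜))) ≠ 0 := (map_ne_zero_iff _ (toTorus_injective h2)).2
    ((map_ne_zero_iff _ τ.injective).2 (Y_ne_zero h2))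
  have hE0 : toTorus h2 (τ (E (q : 𝕜))) ≠ 0 := (map_ne_zero_iff _ (toTorus_injective h2)).2
    ((map_ne_zero_iff _ τ.injective).2 (E_ne_zero h2))
  -- the exponents of `τ Y`
  have wY : ∀ b k i j, cf q b k i j (toTorus h2 (τ (Y (q : 𝕜)))) ≠ 0 → b - i - j = 1 := by
    intro b k i j h
    have := weight_of_cf_ne_zero (w := 1) h2 hinj τ hg hK (by rw [zpow_one]; exact Y_mul_Ku (q : 𝕜)) h
    linarith
  have wE : ∀ b k i j, cf q b k i j (toTorus h2 (τ (E (q : 𝕜)))) ≠ 0 → b - i - j = -2 := by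
    intro b k i j h
    have := weight_of_cf_ne_zero (w := -2) h2 hinj τ hg hK
      (by rw [zpow_neg, zpow_ofNat]; exact E_mul_Ku (q : 𝕜)) h
    linarith
  -- The top `Y`-degrees `b₁`, `b₂` of `τ Y` and `τ E` add up to 0, because the right side of `hYE`
  -- has `Y`-degree 0. For `τ E`, weight `-2` and `i + j + b ≥ 0` give `b₂ ≥ -1`, so `b₁ ≤ 1`; in `τ
  -- Y`, weight 1 gives `b = 1 + i + j ≥ 1`.
  have hYb : ∀ b k i j, cf q b k i j (toTorus h2 (τ (Y (q : 𝕜)))) ≠ 0 → b = 1 ∧ i = 0 ∧ j = 0 := by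
    obtain ⟨⟨b₁, k₁, i₁, j₁⟩, ⟨b₂, k₂, i₂, j₂⟩, h3, h4, h5, -, h6⟩ :=
      TwistedAlgebra.exists_top_mul lexHom_injective hY0 hE0
    have h7 : b₁ + b₂ = 0 := by
      by_contra h0
      apply h6
      change cf q (b₁ + b₂) (k₁ + k₂) (i₁ + i₂) (j₁ + j₂) _ = 0
      have e1 : cf q (b₁ + b₂) (k₁ + k₂) (i₁ + i₂) (j₁ + j₂) (mono q 0 p i j l) = 0 := by
        by_contra h; have := eq_of_cf_mono_ne_zero h; omega
      have e2 : cf q (b₁ + b₂) (k₁ + k₂) (i₁ + i₂) (j₁ + j₂) (mono q 0 p' i' j' l') = 0 := by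
        by_contra h; have := eq_of_cf_mono_ne_zero h; omega
      rw [hYE, map_sub, map_smul, map_smul, e1, e2, smul_zero, sub_zero]
    intro b k i j h
    have h8 : b ≤ b₁ := fst_le_of_lexHom_le (h5 (b, k, i, j) h)
    have := wY _ _ _ _ h
    have := wE _ _ _ _ h4
    have := nonneg_of_cf_ne_zero h2 h
    have := nonneg_of_cf_ne_zero h2 h4
    omega
  -- commutation with `τ X` and `τ φ`
  have cX : toTorus h2 (τ (Y (q : 𝕜))) * mono q 0 p i j l =
      (q : 𝕜) ^ (-1 : ℤ) • (mono q 0 p i j l * toTorus h2 (τ (Y (q : 𝕜)))) := by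
    rw [← hX, ← map_mul, ← map_mul, Y_mul_X, map_smul, map_smul, map_mul, map_mul, zpow_neg_one]
  have cφ : toTorus h2 (τ (Y (q : 𝕜))) * mono q 0 p' i' j' l' =
      (q : 𝕜) ^ (1 : ℤ) • (mono q 0 p' i' j' l' * toTorus h2 (τ (Y (q : 𝕜)))) := by
    have h : Y (q : 𝕜) * phi (q : 𝕜) = (q : 𝕜) ^ (1 : ℤ) • (phi (q : 𝕜) * Y (q : 𝕜)) := by
      apply toTorus_injective h2
      rw [map_mul, map_smul, map_mul, toTorus_Y, toTorus_phi, mono_mul_comm]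
      norm_num
    rw [← hφ, ← map_mul, ← map_mul, h, map_smul, map_smul, map_mul, map_mul]
  have cXφ : p = p' := by
    have h : X (q : 𝕜) * phi (q : 𝕜) = phi (q : 𝕜) * X (q : 𝕜) := by
      apply toTorus_injective h2
      rw [map_mul, map_mul, toTorus_X, toTorus_phi, mono_mul_comm]
      norm_num
    have h3 := congrArg (fun z => toTorus h2 (τ z)) h
    simp only [map_mul, hX, hφ] at h3
    -- Since `i + j = i' + j' = 1`, the commutation exponent of `τ X` with `τ φ` is `p - p'`.
    have h4 := eq_zpow_of_mul_mono_eq (c := (q : 𝕜) ^ (0 : ℤ)) hl' (by rw [zpow_zero, one_smul, h3])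
      ((cf_mono_same 0 p i j l).trans_ne hl)
    have h5 := hinj h4
    have e1 : j = 1 - i := by omega
    have e2 : j' = 1 - i' := by omega
    subst e1 e2
    linarith
  subst cXφ
  have kY : ∀ b k i₀ j₀, cf q b k i₀ j₀ (toTorus h2 (τ (Y (q : 𝕜)))) ≠ 0 →
      b = 1 ∧ k = -p ∧ i₀ = 0 ∧ j₀ = 0 ∧ i = 1 ∧ j = 0 ∧ i' = 0 ∧ j' = 1 := by
    intro b k i₀ j₀ h
    obtain ⟨rfl, rfl, rfl⟩ := hYb _ _ _ _ h
    have h3 := hinj (eq_zpow_of_mul_mono_eq hl cX h)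
    have h4 := hinj (eq_zpow_of_mul_mono_eq hl' cφ h)
    have e1 : j = 1 - i := by omega
    have e2 : j' = 1 - i' := by omega
    subst e1 e2
    -- Both `j - i` and `j' - i'` are `±1`, so `p + k` lies in `{-2, 0}` by `h5` and in `{0, 2}` by
    -- `h6`. Hence `k = -p`, and `X` and `φ` are not exchanged.
    have h5 : -1 = p - i + (1 - i) + k := by linarith
    have h6 : 1 = p - i' + (1 - i') + k := by linarith
    omega
  obtain ⟨⟨b₁, k₁, i₁, j₁⟩, hm⟩ := TwistedAlgebra.exists_coeff_ne_zero hY0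
  obtain ⟨rfl, rfl, rfl, rfl, rfl, rfl, rfl, rfl⟩ := kY _ _ _ _ hm
  obtain ⟨m, hm, hY⟩ : ∃ m : 𝕜, m ≠ 0 ∧ toTorus h2 (τ (Y (q : 𝕜))) = mono q 1 (-p) 0 0 m := by
    refine ⟨_, hm, TwistedAlgebra.eq_single_of_forall ?_⟩
    rintro ⟨b, k, i, j⟩ h
    obtain ⟨rfl, rfl, rfl, rfl, -⟩ := kY _ _ _ _ h
    rfl
  have hK' : τ (Ku (q : 𝕜) : AgeingAlgebra 𝕜 (q : 𝕜)) =
      g • (Ku (q : 𝕜) : AgeingAlgebra 𝕜 (q : 𝕜)) := by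
    apply toTorus_injective h2
    rw [hK, map_smul, toTorus_Ku, smul_mono, mul_one]
  have hX' : τ (X (q : 𝕜)) = l • (Kpow (q : 𝕜) p * X (q : 𝕜)) := by
    apply toTorus_injective h2
    rw [hX, map_smul, map_mul, toTorus_Kpow, toTorus_X, mono_mul_mono, smul_mono]
    norm_num
  have hφ' : τ (phi (q : 𝕜)) = l' • (Kpow (q : 𝕜) p * phi (q : 𝕜)) := by
    apply toTorus_injective h2
    rw [hφ, map_smul, map_mul, toTorus_Kpow, toTorus_phi, mono_mul_mono, smul_mono]
    norm_num
  have hY' : τ (Y (q : 𝕜)) = m • (Kpow (q : 𝕜) (-p) * Y (q : 𝕜)) := by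
    apply toTorus_injective h2
    rw [hY, map_smul, map_mul, toTorus_Kpow, toTorus_Y, mono_mul_mono, smul_mono]
    norm_num
  -- comparison of the scalars
  have hll : l' = l := by
    -- Left multiplication by `m⁻¹ K ^ p` turns `τ Y` into `Y`, and right multiplication by `K ^
    -- (-(2 * p))` removes the remaining power of `K` at the cost of `q ^ (2 * p)`. The result lies
    -- in the right ideal of `Y` and in the span of `X` and `φ`.
    have h3 : toTorus h2 (Y (q : 𝕜) * (τ (E (q : 𝕜)) * Kpow (q : 𝕜) (-(2 * p)))) =
        mono q 0 0 0 1 (m⁻¹ * ((q : 𝕜)⁻¹ - q)⁻¹ * (q : 𝕜) ^ (2 * p) * l') -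
        mono q 0 0 1 0 (m⁻¹ * ((q : 𝕜)⁻¹ - q)⁻¹ * (q : 𝕜) ^ (2 * p) * l) := by
      have h4 : mono q 1 0 0 0 1 = mono q 0 p 0 0 m⁻¹ * mono q 1 (-p) 0 0 m := by
        rw [mono_mul_mono]
        norm_num [hm]
      have h5 : p + p + -(2 * p) = 0 := by ring
      rw [map_mul, map_mul, toTorus_Y, toTorus_Kpow, h4, ← hY, mul_assoc, ← mul_assoc _ _ (mono ..),
        hYE, sub_mul, mul_sub, smul_mul_assoc, smul_mul_assoc, mul_smul_comm, mul_smul_comm,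
        ← mul_assoc, ← mul_assoc, mono_mul_mono, mono_mul_mono, mono_mul_mono, mono_mul_mono,
        smul_mono, smul_mono, h5]
      norm_num
      congr 2 <;> ring
    refine mul_left_cancel₀ ?_ (eq_of_Y_mul_eq h2 h3)
    exact mul_ne_zero (mul_ne_zero (inv_ne_zero hm) (inv_ne_zero h2)) (zpow_ne_zero _ q.ne_zero)
  subst hll
  refine ⟨Units.mk0 l' hl, Units.mk0 m hm, Units.mk0 g hg, p, ?_⟩
  have hE' : τ (E (q : 𝕜)) =
      sigma q (Units.mk0 l' hl) (Units.mk0 m hm) (Units.mk0 g hg) p (E (q : 𝕜)) := by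
    refine mul_left_cancel_of_ne_zero h2 ((map_ne_zero_iff τ τ.injective).2 (Y_ne_zero h2)) ?_
    rw [← map_mul, Y_mul_E h2, map_sub, map_smul, map_smul, hX', hφ', hY']
    have h3 := sigma_Y_mul_E q (Units.mk0 l' hl) (Units.mk0 m hm) (Units.mk0 g hg) p
    rw [map_mul, sigma_Y, Y_mul_E h2] at h3
    refine Eq.trans ?_ h3.symm
    rw [mul_sub, mul_smul_comm, mul_smul_comm, Units.val_mk0, smul_sub, smul_comm l',
      smul_comm l']
  have := algHom_ext (f := (τ : AgeingAlgebra 𝕜 (q : 𝕜) →ₐ[𝕜] AgeingAlgebra 𝕜 (q : 𝕜)))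
    (g := (sigma q (Units.mk0 l' hl) (Units.mk0 m hm) (Units.mk0 g hg) p :
      AgeingAlgebra 𝕜 (q : 𝕜) →ₐ[𝕜] AgeingAlgebra 𝕜 (q : 𝕜)))
    hE' (hX'.trans (sigma_X q (Units.mk0 l' hl) (Units.mk0 m hm) (Units.mk0 g hg) p).symm)
    (hY'.trans (sigma_Y q (Units.mk0 l' hl) (Units.mk0 m hm) (Units.mk0 g hg) p).symm)
    (hK'.trans (sigma_Ku q (Units.mk0 l' hl) (Units.mk0 m hm) (Units.mk0 g hg) p).symm)
  exact AlgEquiv.ext fun a => DFunLike.congr_fun this a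

/-! ### The semidirect product -/

variable (q)

/-- The homomorphism from the semidirect product to the group of automorphisms. -/
def semidirectHom : (𝕜ˣ × 𝕜ˣ × 𝕜ˣ) ⋊[torusAction 𝕜] Multiplicative ℤ →*
    (AgeingAlgebra 𝕜 (q : 𝕜) ≃ₐ[𝕜] AgeingAlgebra 𝕜 (q : 𝕜)) where
  -- This is `sigma q l m g 0 * sigma q 1 1 1 i`, evaluated by the composition formula.
  toFun s := sigma q (s.left.1 * s.left.2.2 ^ s.right.toAdd)
    (s.left.2.1 * s.left.2.2 ^ (-s.right.toAdd)) s.left.2.2 s.right.toAdd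
  map_one' := by
    rw [← sigma_one]
    simp
  map_mul' := by
    rintro ⟨⟨l, m, g⟩, i⟩ ⟨⟨l', m', g'⟩, j⟩
    change sigma q (l * (l' * g' ^ (-i.toAdd)) * (g * g') ^ (i.toAdd + j.toAdd))
      (m * (m' * g' ^ i.toAdd) * (g * g') ^ (-(i.toAdd + j.toAdd))) (g * g') (i.toAdd + j.toAdd) =
      sigma q (l * g ^ i.toAdd) (m * g ^ (-i.toAdd)) g i.toAdd *
        sigma q (l' * g' ^ j.toAdd) (m' * g' ^ (-j.toAdd)) g' j.toAdd
    rw [sigma_mul]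
    congr 1 <;>
    · ext
      simp only [mul_zpow, zpow_add, zpow_neg, neg_add, Units.val_mul, Units.val_inv_eq_inv_val]
      field_simp

variable {q}

include h2 in
-- The parameters can be read off in the torus: `X` determines `i` and `l`, `Y` determines `m`, and
-- `K` determines `g`.
theorem eq_one_of_sigma_eq_one {l m g : 𝕜ˣ} {i : ℤ} (h : sigma q l m g i = 1) :
    l = 1 ∧ m = 1 ∧ g = 1 ∧ i = 0 := by
  have hX : toTorus h2 (sigma q l m g i (X (q : 𝕜))) = toTorus h2 (X (q : 𝕜)) := by rw [h]; rfl
  have hY : toTorus h2 (sigma q l m g i (Y (q : 𝕜))) = toTorus h2 (Y (q : 𝕜)) := by rw [h]; rfl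
  have hK : toTorus h2 (sigma q l m g i (Ku (q : 𝕜) : AgeingAlgebra 𝕜 (q : 𝕜))) =
      toTorus h2 (Ku (q : 𝕜) : AgeingAlgebra 𝕜 (q : 𝕜)) := by rw [h]; rfl
  rw [sigma_X, map_smul, map_mul, toTorus_Kpow, toTorus_X, mono_mul_mono, smul_mono] at hX
  norm_num at hX
  have hi : i = 0 := by
    have : cf q 0 i 1 0 (mono q 0 0 1 0 1) ≠ 0 := by
      rw [← hX, cf_mono_same]
      exact l.ne_zero
    exact (eq_of_cf_mono_ne_zero this).2.1
  subst hi
  rw [sigma_Y, map_smul, map_mul, toTorus_Kpow, toTorus_Y, mono_mul_mono, smul_mono] at hY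
  norm_num at hY
  rw [sigma_Ku, map_smul, toTorus_Ku, smul_mono, mul_one] at hK
  have hl := congrArg (cf q 0 0 1 0) hX
  have hm := congrArg (cf q 1 0 0 0) hY
  have hg := congrArg (cf q 0 1 0 0) hK
  rw [cf_mono_same, cf_mono_same] at hl hm hg
  exact ⟨Units.ext hl, Units.ext hm, Units.ext hg, rfl⟩

include h2 hinj in
theorem semidirectHom_bijective : Function.Bijective (semidirectHom q) := by
  constructor
  · rw [injective_iff_map_eq_one]
    intro s hs
    obtain ⟨h1, h3, h4, h5⟩ := eq_one_of_sigma_eq_one h2 hs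
    rw [h4, one_zpow, mul_one] at h1 h3
    exact SemidirectProduct.ext (Prod.ext h1 (Prod.ext h3 h4)) h5
  · intro τ
    obtain ⟨l, m, g, i, rfl⟩ := exists_eq_sigma h2 hinj τ
    refine ⟨⟨(l * g ^ (-i), m * g ^ i, g), Multiplicative.ofAdd i⟩, ?_⟩
    change sigma q (l * g ^ (-i) * g ^ i) (m * g ^ i * g ^ (-i)) g i = _
    congr 1 <;> simp

theorem zpow_injective_of_pow_ne_one {q : 𝕜ˣ} (hq : ∀ n : ℕ, 0 < n → (q : 𝕜) ^ n ≠ 1) :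
    Function.Injective fun n : ℤ => (q : 𝕜) ^ n := by
  have h : ¬ IsOfFinOrder q := by
    rw [isOfFinOrder_iff_pow_eq_one]
    rintro ⟨n, hn, h⟩
    exact hq n hn (by rw [← Units.val_pow_eq_pow_val, h, Units.val_one])
  intro m n hmn
  refine injective_zpow_iff_not_isOfFinOrder.2 h (Units.ext ?_)
  simpa using hmn

end

end AgeingAlgebra

/-! ### The main theorem -/

theorem theorem3 {𝕜 : Type*} [Field 𝕜] (q : 𝕜) (hq0 : q ≠ 0)
    (hq : ∀ n : ℕ, 0 < n → q ^ n ≠ 1) :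
    ∃ σ : 𝕜ˣ → 𝕜ˣ → 𝕜ˣ → ℤ → (AgeingAlgebra 𝕜 q ≃ₐ[𝕜] AgeingAlgebra 𝕜 q),
      -- the action on the generators and on `φ`
      (∀ (l m g : 𝕜ˣ) (i : ℤ),
        σ l m g i (AgeingAlgebra.X q) =
          (l : 𝕜) • (AgeingAlgebra.Kpow q i * AgeingAlgebra.X q) ∧
        σ l m g i (AgeingAlgebra.Y q) =
          (m : 𝕜) • (AgeingAlgebra.Kpow q (-i) * AgeingAlgebra.Y q) ∧
        σ l m g i (AgeingAlgebra.Ku q : AgeingAlgebra 𝕜 q) =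
          (g : 𝕜) • (AgeingAlgebra.Ku q : AgeingAlgebra 𝕜 q) ∧
        σ l m g i (AgeingAlgebra.E q) =
          ((l : 𝕜) * (m : 𝕜)⁻¹ * q ^ (-2 * i)) •
            (AgeingAlgebra.Kpow q (2 * i) * AgeingAlgebra.E q) ∧
        σ l m g i (AgeingAlgebra.phi q) =
          (l : 𝕜) • (AgeingAlgebra.Kpow q i * AgeingAlgebra.phi q)) ∧
      -- every automorphism is of this form
      (∀ τ : AgeingAlgebra 𝕜 q ≃ₐ[𝕜] AgeingAlgebra 𝕜 q,
        ∃ (l m g : 𝕜ˣ) (i : ℤ), τ = σ l m g i) ∧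
      -- composition
      (∀ (l m g l' m' g' : 𝕜ˣ) (i j : ℤ),
        σ l m g i * σ l' m' g' j =
          σ (l * l' * g ^ j) (m * m' * g ^ (-j)) (g * g') (i + j)) ∧
      -- inverses
      (∀ (l m g : 𝕜ˣ) (i : ℤ),
        (σ l m g i)⁻¹ = σ (l⁻¹ * g ^ i) (m⁻¹ * g ^ (-i)) g⁻¹ (-i)) ∧
      -- the isomorphism with the semidirect product
      (∃ Ψ : (𝕜ˣ × 𝕜ˣ × 𝕜ˣ) ⋊[AgeingAlgebra.torusAction 𝕜] Multiplicative ℤ ≃*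
          (AgeingAlgebra 𝕜 q ≃ₐ[𝕜] AgeingAlgebra 𝕜 q),
        (∀ l m g : 𝕜ˣ, Ψ (SemidirectProduct.inl (l, m, g)) = σ l m g 0) ∧
        (∀ i : ℤ, Ψ (SemidirectProduct.inr (Multiplicative.ofAdd i)) = σ 1 1 1 i)) := by
  obtain ⟨q, rfl⟩ : ∃ u : 𝕜ˣ, (u : 𝕜) = q := ⟨Units.mk0 q hq0, rfl⟩
  have hinj := AgeingAlgebra.zpow_injective_of_pow_ne_one hq
  -- If `q⁻¹ = q`, two different powers of `q` would coincide. This is the denominator in the image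
  -- of `E` in the torus.
  have h2 : (q : 𝕜)⁻¹ - q ≠ 0 := fun h => by
    have h' : (q : 𝕜) ^ (-1 : ℤ) = (q : 𝕜) ^ (1 : ℤ) := by
      rw [zpow_neg_one, zpow_one]
      exact sub_eq_zero.1 h
    exact absurd (hinj h') (by norm_num)
  refine ⟨AgeingAlgebra.sigma q, fun l m g i => ⟨AgeingAlgebra.sigma_X q l m g i,
    AgeingAlgebra.sigma_Y q l m g i, AgeingAlgebra.sigma_Ku q l m g i,
    AgeingAlgebra.sigma_E q l m g i, AgeingAlgebra.sigma_phi q l m g i⟩,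
    AgeingAlgebra.exists_eq_sigma h2 hinj, AgeingAlgebra.sigma_mul q, AgeingAlgebra.sigma_inv q,
    MulEquiv.ofBijective (AgeingAlgebra.semidirectHom q)
      (AgeingAlgebra.semidirectHom_bijective h2 hinj), fun l m g => ?_, fun i => ?_⟩
  · change AgeingAlgebra.sigma q (l * g ^ (0 : ℤ)) (m * g ^ (-(0 : ℤ))) g 0 = _
    simp
  · change AgeingAlgebra.sigma q (1 * 1 ^ i) (1 * 1 ^ (-i)) 1 i = _
    simp
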